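/- **Conventions.** A *computable metric space* is a complete metric space $X$ with a dense sequence $(s_i)_{i\in\mathbb N}$ of ideal points whose distances $d(s_i,s_j)$ are computable reals uniformly in $i,j$ (both sets $\{(i,j,q): q\in\mathbb Q,\ q<d(s_i,s_j)\}$ and $\{(i,j,q): q\in\mathbb Q,\ d(s_i,s_j)<q\}$ are r.e.). An *ideal ball* is an open ball $B(s_i,q)$, $q\in\mathbb Q_{>0}$; fix the standard effective numbering $(B_n)_n$ of ideal balls. A point is *computable* if the set of $n$ with $x\in B_n$ is r.e., and a sequence $(x_k)$ is computable if $\{(k,n): x_k\in B_n\}$ is r.e. Sets $U_n$ are *uniformly recursively open* if $U_n=\bigcup_{(n,i)\in E}B_i$ for one r.e. set $E\subseteq\mathbb N^2$. A map $T:X\to Y$ is *computable* if the sets $T^{-1}(B^Y_n)$ are uniformly recursively open; maps $f_i$ are *uniformly computable on* $C$ if there are sets $U_{i,n}$, uniformly recursively open, with $f_i^{-1}(B^Y_n)\cap C=U_{i,n}\cap C$. A compact set $K$ is *recursively compact* if the finite lists of ideal balls that cover $K$ form an r.e. set. A Borel probability measure $\mu$ on a bounded computable metric space is *computable* if there is a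 recursive sequence $(\mu_n)$ of finite rational convex combinations of Dirac masses at ideal points with $W_1(\mu_n,\mu)<2^{-n}$ for all $n$, where $W_1(\mu,\nu)=\sup\{|\int f\,d\mu-\int f\,d\nu| : f \text{ 1-Lipschitz}\}$. The line $\mathbb R$ and the circle $\mathbb R/\mathbb Z$ (arc length distance) are computable metric spaces, with the rationals, respectively the rationals mod $1$, as ideal points. **Construction.** Let $K\subseteq[0,1]$ be a nonempty recursively compact set without computable points. Let $(a_i)_{i\ge 0},(b_i)_{i\ge 0}$ be computable sequences of reals with $0<a_i<b_i<1$ and $(0,1)\setminus K=\bigcup_i(a_i,b_i)$, let $\varepsilon>0$ be rational with $K\subseteq[\varepsilon,1-\varepsilon]$, and let $f_i:[0,1]\to[0,1]$ be nondecreasing maps, uniformly computable on $[0,1]$, with $f_i(x)>x$ for $x\in(a_i,b_i)$ and $f_i(x)=x$ for all other $x\in[0,1]$. Let $f(x)=\varepsilon$ on $[0,\varepsilon]$, $f(x)=x$ on $[\varepsilon,1-\varepsilon]$, $f(x)=2x-(1-\varepsilon)$ on $[1-\varepsilon,1]$, and $$\tilde T(x)=\tfrac12 f(x)+\sum_{i\ge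 0}2^{-(i+2)}f_i(x)\qquad(x\in[0,1]).$$ **Proposition 6.2.** 1. A nonempty recursively compact set $K\subseteq[0,1]$ without computable points exists. For every such $K$, data $(a_i),(b_i),\varepsilon,(f_i)$ as in the construction exist; moreover $(a_i),(b_i),\varepsilon$ can be chosen so that one may take $f_i(x)=2x-a_i$ on $[a_i,\frac{a_i+b_i}2]$, $f_i(x)=b_i$ on $[\frac{a_i+b_i}2,b_i]$, and $f_i(x)=x$ elsewhere. 2. For every such $K$ and all data as in the construction, $\tilde T$ descends to a map $T$ of the circle $\mathbb R/\mathbb Z$, that is, $T(x \bmod 1)=\tilde T(x)\bmod 1$ for all $x\in[0,1]$. The map $T$ is computable, every $T$-invariant Borel probability measure $\mu$ satisfies $\mu\big((\mathbb R/\mathbb Z)\setminus (K\bmod 1)\big)=0$, and no $T$-invariant Borel probability measure is computable. 3. If $\mu$ is a computable Borel probability measure on a bounded computable metric space, then the support of $\mu$ contains a computable point. In particular, there is a computable map of the circle that has no computable invariant probability measure. -/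

import Mathlib

open MeasureTheory Set
open scoped ENNReal

namespace LabelBomb

/-! ### Numberings of the rationals -/

/-- The effective numbering of the rationals: `⟨⟨a, b⟩, c⟩ ↦ (a - b) / (c + 1)`. -/
def ratOfCode (n : ℕ) : ℚ :=
  ((n.unpair.1.unpair.1 : ℚ) - n.unpair.1.unpair.2) / (n.unpair.2 + 1)

/-- The effective numbering of the positive rationals: `⟨a, b⟩ ↦ (a + 1) / (b + 1)`. -/
def posRatOfCode (n : ℕ) : ℚ := ((n.unpair.1 : ℚ) + 1) / (n.unpair.2 + 1)

/-! ### Computable metric spaces -/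

/-- A computable metric space: a complete metric space with a dense sequence of ideal points,
whose mutual distances are computable reals (both cuts are r.e.), uniformly in the indices. -/
class ComputableMetricSpace (X : Type*) [MetricSpace X] where
  complete : CompleteSpace X
  /-- the numbered set of ideal points -/
  idealPt : ℕ → X
  dense : DenseRange idealPt
  dist_lower : REPred fun p : (ℕ × ℕ) × ℕ =>
    (ratOfCode p.2 : ℝ) < dist (idealPt p.1.1) (idealPt p.1.2)
  dist_upper : REPred fun p : (ℕ × ℕ) × ℕ =>
    dist (idealPt p.1.1) (idealPt p.1.2) < (ratOfCode p.2 : ℝ)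

section Notions

variable {X Y : Type*} [MetricSpace X] [ComputableMetricSpace X]
  [MetricSpace Y] [ComputableMetricSpace Y]

/-- The ideal ball with number `⟨i, j⟩`: the open ball around the `i`-th ideal point whose radius
is the `j`-th positive rational. -/
def idealBall (X : Type*) [MetricSpace X] [ComputableMetricSpace X] (n : ℕ) : Set X :=
  Metric.ball (ComputableMetricSpace.idealPt n.unpair.1) (posRatOfCode n.unpair.2 : ℝ)

/-- A point is computable if the set of ideal balls that contain it is r.e. -/
def IsComputablePoint (x : X) : Prop := REPred fun n : ℕ => x ∈ idealBall X n

/-- A computable sequence of points: the terms are computable, uniformly in the index. -/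
def IsComputableSeq (x : ℕ → X) : Prop :=
  REPred fun p : ℕ × ℕ => x p.1 ∈ idealBall X p.2

/-- A sequence of sets is recursively open, uniformly in the index: `U n` is the union of the
ideal balls with number in the `n`-th section of one r.e. set. -/
def UniformlyRecOpen (U : ℕ → Set X) : Prop :=
  ∃ E : ℕ × ℕ → Prop, REPred E ∧ ∀ n, U n = ⋃ i ∈ {i | E (n, i)}, idealBall X i

/-- A map between computable metric spaces is computable if the preimages of the ideal balls
are recursively open, uniformly. -/
def IsComputableMap (T : X → Y) : Prop :=
  UniformlyRecOpen fun n => T ⁻¹' idealBall Y n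

/-- The maps `f i` are computable on the set `C`, uniformly in `i`. -/
def UniformlyComputableOn (f : ℕ → X → Y) (C : Set X) : Prop :=
  ∃ U : ℕ → Set X, UniformlyRecOpen U ∧
    ∀ i n, f i ⁻¹' idealBall Y n ∩ C = U (Nat.pair i n) ∩ C

/-- A set is recursively compact if it is compact and one can semi-decide whether a given finite
list of ideal balls covers it. -/
def IsRecCompact (K : Set X) : Prop :=
  IsCompact K ∧ REPred fun l : List ℕ => K ⊆ ⋃ i ∈ {i | i ∈ l}, idealBall X i

/-! ### Computable probability measures -/

/-- The Wasserstein-Kantorovich distance of two probability measures on a bounded metric space. -/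
noncomputable def W₁ {X : Type*} [MetricSpace X] [BoundedSpace X] [MeasurableSpace X]
    (μ ν : Measure X) : ℝ≥0∞ :=
  ⨆ (f : X → ℝ) (_ : LipschitzWith 1 f), ENNReal.ofReal |∫ x, f x ∂μ - ∫ x, f x ∂ν|

/-- The sum of the weights `w + 1` in a list of pairs `(i, w)`. -/
def totalWeight (l : List (ℕ × ℕ)) : ℕ := (l.map fun p => p.2 + 1).sum

/-- The numbered set of ideal measures: the finite convex combinations, with rational
coefficients, of Dirac measures at ideal points. A name is a nonempty list of pairs `(i, w)`
(given by its head and its tail); it stands for the combination of the Dirac measures at the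
`i`-th ideal points with coefficients proportional to `w + 1`. -/
noncomputable def idealMeasure (X : Type*) [MetricSpace X] [ComputableMetricSpace X]
    [MeasurableSpace X] (c : (ℕ × ℕ) × List (ℕ × ℕ)) : Measure X :=
  (totalWeight (c.1 :: c.2) : ℝ≥0∞)⁻¹ •
    ((c.1 :: c.2).map fun p => ((p.2 + 1 : ℕ) : ℝ≥0∞) •
      Measure.dirac (ComputableMetricSpace.idealPt p.1 : X)).sum

/-- A probability measure is computable if some recursive sequence of ideal measures converges
to it fast in the distance `W₁`. -/
def IsComputableMeasure [BoundedSpace X] [MeasurableSpace X] (μ : Measure X) : Prop :=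
  ∃ φ : ℕ → (ℕ × ℕ) × List (ℕ × ℕ), Computable φ ∧
    ∀ n, W₁ (idealMeasure X (φ n)) μ < ENNReal.ofReal ((1 / 2 : ℝ) ^ n)

end Notions

/-! ### The real line and the circle as computable metric spaces -/

theorem lt_div_iff_nat (q M d : ℕ) :
    ((ratOfCode q : ℚ) : ℝ) < (M : ℝ) / ((d : ℝ) + 1) ↔
      q.unpair.1.unpair.1 * (d + 1) < M * (q.unpair.2 + 1) + q.unpair.1.unpair.2 * (d + 1) := by
  unfold ratOfCode
  push_cast
  rw [div_lt_div_iff₀ (by positivity) (by positivity), sub_mul, sub_lt_iff_lt_add]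
  norm_cast

theorem div_lt_iff_nat (q M d : ℕ) :
    (M : ℝ) / ((d : ℝ) + 1) < ((ratOfCode q : ℚ) : ℝ) ↔
      M * (q.unpair.2 + 1) + q.unpair.1.unpair.2 * (d + 1) < q.unpair.1.unpair.1 * (d + 1) := by
  unfold ratOfCode
  push_cast
  rw [div_lt_div_iff₀ (by positivity) (by positivity), sub_mul, lt_sub_iff_add_lt]
  norm_cast

theorem primrec_sides {M d : ℕ × ℕ → ℕ} (hM : Primrec M) (hd : Primrec d) :
    (Primrec fun p : (ℕ × ℕ) × ℕ => p.2.unpair.1.unpair.1 * (d p.1 + 1)) ∧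
    (Primrec fun p : (ℕ × ℕ) × ℕ =>
      M p.1 * (p.2.unpair.2 + 1) + p.2.unpair.1.unpair.2 * (d p.1 + 1)) := by
  have hq : Primrec fun p : (ℕ × ℕ) × ℕ => p.2.unpair := Primrec.unpair.comp Primrec.snd
  have hq1 := Primrec.unpair.comp (Primrec.fst.comp hq)
  have hd' := Primrec.succ.comp (hd.comp (Primrec.fst (α := ℕ × ℕ) (β := ℕ)))
  have hM' := hM.comp (Primrec.fst (α := ℕ × ℕ) (β := ℕ))
  exact ⟨Primrec.nat_mul.comp (Primrec.fst.comp hq1) hd',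
    Primrec.nat_add.comp
      (Primrec.nat_mul.comp hM' (Primrec.succ.comp (Primrec.snd.comp hq)))
      (Primrec.nat_mul.comp (Primrec.snd.comp hq1) hd')⟩

theorem re_lower {δ : ℕ × ℕ → ℝ} {M d : ℕ × ℕ → ℕ} (hM : Primrec M) (hd : Primrec d)
    (h : ∀ p, δ p = (M p : ℝ) / ((d p : ℝ) + 1)) :
    REPred fun p : (ℕ × ℕ) × ℕ => (ratOfCode p.2 : ℝ) < δ p.1 :=
  (Primrec.nat_lt.comp (primrec_sides hM hd).1 (primrec_sides hM hd).2).computablePred.to_re.of_eq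
    fun p => by rw [h, lt_div_iff_nat]

theorem re_upper {δ : ℕ × ℕ → ℝ} {M d : ℕ × ℕ → ℕ} (hM : Primrec M) (hd : Primrec d)
    (h : ∀ p, δ p = (M p : ℝ) / ((d p : ℝ) + 1)) :
    REPred fun p : (ℕ × ℕ) × ℕ => δ p.1 < (ratOfCode p.2 : ℝ) :=
  (Primrec.nat_lt.comp (primrec_sides hM hd).2 (primrec_sides hM hd).1).computablePred.to_re.of_eq
    fun p => by rw [h, div_lt_iff_nat]

theorem ratOfCode_surjective : Function.Surjective ratOfCode := by
  intro q
  refine ⟨Nat.pair (Nat.pair q.num.toNat (-q.num).toNat) (q.den - 1), ?_⟩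
  have h1 : ((q.num.toNat : ℚ) - (-q.num).toNat) = q.num := by
    have : ((q.num.toNat : ℤ) - (-q.num).toNat) = q.num := by omega
    exact_mod_cast this
  have h2 : (((q.den - 1 : ℕ) : ℚ) + 1) = q.den := by
    have := q.pos
    have h : q.den - 1 + 1 = q.den := by omega
    exact_mod_cast h
  simp only [ratOfCode, Nat.unpair_pair]
  rw [h1, h2, Rat.num_div_den]

/-- The numerator of the distance of two rationals over the product of their denominators. -/
def realNum (p : ℕ × ℕ) : ℕ :=
  let A := p.1.unpair.1.unpair.1 * (p.2.unpair.2 + 1) +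
    p.2.unpair.1.unpair.2 * (p.1.unpair.2 + 1)
  let B := p.1.unpair.1.unpair.2 * (p.2.unpair.2 + 1) +
    p.2.unpair.1.unpair.1 * (p.1.unpair.2 + 1)
  (A - B) + (B - A)

/-- The product of two denominators, minus one. -/
def denPred (p : ℕ × ℕ) : ℕ :=
  p.1.unpair.2 * p.2.unpair.2 + p.1.unpair.2 + p.2.unpair.2

/-- The numerator of the distance on the circle of `a / (c + 1)` and `a' / (c' + 1)` over the
product of their denominators. -/
def circleNum (p : ℕ × ℕ) : ℕ :=
  let r := (p.1.unpair.1 * (p.2.unpair.2 + 1) +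
    p.2.unpair.1 * (p.1.unpair.2 + 1) * denPred p) % (denPred p + 1)
  min r (denPred p + 1 - r)

theorem primrec_denPred : Primrec denPred := by
  have h1 : Primrec fun p : ℕ × ℕ => p.1.unpair.2 :=
    Primrec.snd.comp (Primrec.unpair.comp Primrec.fst)
  have h2 : Primrec fun p : ℕ × ℕ => p.2.unpair.2 :=
    Primrec.snd.comp (Primrec.unpair.comp Primrec.snd)
  exact Primrec.nat_add.comp (Primrec.nat_add.comp (Primrec.nat_mul.comp h1 h2) h1) h2

theorem primrec_realNum : Primrec realNum := by
  have u1 : Primrec fun p : ℕ × ℕ => p.1.unpair := Primrec.unpair.comp Primrec.fst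
  have u2 : Primrec fun p : ℕ × ℕ => p.2.unpair := Primrec.unpair.comp Primrec.snd
  have v1 := Primrec.unpair.comp (Primrec.fst.comp u1)
  have v2 := Primrec.unpair.comp (Primrec.fst.comp u2)
  have c1 := Primrec.succ.comp (Primrec.snd.comp u1)
  have c2 := Primrec.succ.comp (Primrec.snd.comp u2)
  have hA := Primrec.nat_add.comp (Primrec.nat_mul.comp (Primrec.fst.comp v1) c2)
    (Primrec.nat_mul.comp (Primrec.snd.comp v2) c1)
  have hB := Primrec.nat_add.comp (Primrec.nat_mul.comp (Primrec.snd.comp v1) c2)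
    (Primrec.nat_mul.comp (Primrec.fst.comp v2) c1)
  exact Primrec.nat_add.comp (Primrec.nat_sub.comp hA hB) (Primrec.nat_sub.comp hB hA)

theorem primrec_circleNum : Primrec circleNum := by
  have u1 : Primrec fun p : ℕ × ℕ => p.1.unpair := Primrec.unpair.comp Primrec.fst
  have u2 : Primrec fun p : ℕ × ℕ => p.2.unpair := Primrec.unpair.comp Primrec.snd
  have c1 := Primrec.succ.comp (Primrec.snd.comp u1)
  have c2 := Primrec.succ.comp (Primrec.snd.comp u2)
  have hD := Primrec.succ.comp primrec_denPred
  have hr := Primrec.nat_mod.comp (Primrec.nat_add.comp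
    (Primrec.nat_mul.comp (Primrec.fst.comp u1) c2)
    (Primrec.nat_mul.comp (Primrec.nat_mul.comp (Primrec.fst.comp u2) c1) primrec_denPred)) hD
  exact Primrec.nat_min.comp hr (Primrec.nat_sub.comp hD hr)

theorem real_dist_eq (p : ℕ × ℕ) :
    dist (ratOfCode p.1 : ℝ) (ratOfCode p.2 : ℝ) =
      (realNum p : ℝ) / ((denPred p : ℝ) + 1) := by
  have key : ∀ A B : ℕ, (((A - B) + (B - A) : ℕ) : ℝ) = |(A : ℝ) - B| := by
    intro A B
    rcases le_total A B with h | h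
    · rw [Nat.sub_eq_zero_of_le h, zero_add, Nat.cast_sub h, abs_sub_comm,
        abs_of_nonneg (sub_nonneg.2 (by exact_mod_cast h))]
    · rw [Nat.sub_eq_zero_of_le h, add_zero, Nat.cast_sub h,
        abs_of_nonneg (sub_nonneg.2 (by exact_mod_cast h))]
  have hD : ((denPred p : ℝ) + 1) = ((p.1.unpair.2 : ℝ) + 1) * ((p.2.unpair.2 : ℝ) + 1) := by
    unfold denPred
    push_cast
    ring
  have hpos : (0 : ℝ) < (denPred p : ℝ) + 1 := by positivity
  unfold realNum
  rw [key, Real.dist_eq]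
  conv_rhs => rw [← abs_of_pos hpos, ← abs_div, hD]
  congr 1
  unfold ratOfCode
  push_cast
  field_simp
  ring

theorem circle_dist_eq (p : ℕ × ℕ) :
    dist (((p.1.unpair.1 : ℝ) / ((p.1.unpair.2 : ℝ) + 1) : ℝ) : UnitAddCircle)
      (((p.2.unpair.1 : ℝ) / ((p.2.unpair.2 : ℝ) + 1) : ℝ) : UnitAddCircle) =
      (circleNum p : ℝ) / ((denPred p : ℝ) + 1) := by
  set r := p.1.unpair.1 * (p.2.unpair.2 + 1) +
    p.2.unpair.1 * (p.1.unpair.2 + 1) * denPred p with hr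
  have hD : ((denPred p : ℝ) + 1) = ((p.1.unpair.2 : ℝ) + 1) * ((p.2.unpair.2 : ℝ) + 1) := by
    unfold denPred
    push_cast
    ring
  have hrD : ((r : ℝ) / ((denPred p + 1 : ℕ) : ℝ) * 1) =
      (p.1.unpair.1 : ℝ) / ((p.1.unpair.2 : ℝ) + 1) -
        (p.2.unpair.1 : ℝ) / ((p.2.unpair.2 : ℝ) + 1) +
      (p.2.unpair.1 * (p.1.unpair.2 + 1) : ℕ) := by
    have e : (denPred p : ℝ) = ((p.1.unpair.2 : ℝ) + 1) * ((p.2.unpair.2 : ℝ) + 1) - 1 := by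
      rw [← hD]; ring
    rw [hr]
    push_cast
    rw [e]
    field_simp
    ring
  have hz : (((p.2.unpair.1 * (p.1.unpair.2 + 1) : ℕ) : ℝ) : UnitAddCircle) = 0 := by
    rw [AddCircle.coe_eq_zero_iff]
    exact ⟨(p.2.unpair.1 * (p.1.unpair.2 + 1) : ℕ), by simp⟩
  have h := AddCircle.norm_div_natCast (p := (1 : ℝ)) (m := r) (n := denPred p + 1)
  rw [hrD, AddCircle.coe_add, hz, add_zero, AddCircle.coe_sub, ← dist_eq_norm, one_mul] at h
  refine h.trans ?_
  unfold circleNum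
  rw [← hr]
  push_cast
  rfl

/-- The real line, with the rationals as ideal points. -/
noncomputable instance : ComputableMetricSpace ℝ where
  complete := inferInstance
  idealPt n := (ratOfCode n : ℝ)
  dense := Rat.denseRange_cast.comp ratOfCode_surjective.denseRange
    Rat.continuous_coe_real
  dist_lower := re_lower (δ := fun p => dist (ratOfCode p.1 : ℝ) (ratOfCode p.2 : ℝ))
    primrec_realNum primrec_denPred real_dist_eq
  dist_upper := re_upper (δ := fun p => dist (ratOfCode p.1 : ℝ) (ratOfCode p.2 : ℝ))
    primrec_realNum primrec_denPred real_dist_eq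

theorem dense_circle : DenseRange fun n : ℕ =>
    (((n.unpair.1 : ℝ) / ((n.unpair.2 : ℝ) + 1) : ℝ) : UnitAddCircle) := by
  have hs : Function.Surjective ((↑) : ℝ → UnitAddCircle) := QuotientAddGroup.mk_surjective
  have h1 : DenseRange fun q : ℚ => ((q : ℝ) : UnitAddCircle) :=
    hs.denseRange.comp Rat.denseRange_cast (AddCircle.continuous_mk' 1)
  refine h1.mono ?_
  rintro _ ⟨q, rfl⟩
  refine ⟨Nat.pair (q.num % q.den).toNat (q.den - 1), ?_⟩
  have hpos : (0 : ℤ) < q.den := by exact_mod_cast q.pos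
  have h0 : 0 ≤ q.num % q.den := Int.emod_nonneg _ hpos.ne'
  have hd : (((q.den - 1 : ℕ) : ℝ) + 1) = q.den := by
    have h : q.den - 1 + 1 = q.den := by have := q.pos; omega
    exact_mod_cast h
  have hn : (((q.num % q.den).toNat : ℕ) : ℝ) = (q.num : ℝ) - q.den * (q.num / q.den : ℤ) := by
    have h : (((q.num % q.den).toNat : ℕ) : ℤ) = q.num - q.den * (q.num / q.den : ℤ) := by
      rw [Int.toNat_of_nonneg h0, Int.emod_def]
    exact_mod_cast h
  have hq : (q : ℝ) = (q.num : ℝ) / q.den := by exact_mod_cast (Rat.num_div_den q).symm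
  have hne : (q.den : ℝ) ≠ 0 := by exact_mod_cast q.pos.ne'
  simp only [Nat.unpair_pair]
  rw [hd, hn, sub_div, mul_div_cancel_left₀ _ hne, ← hq, AddCircle.coe_sub]
  have hz : (((q.num / q.den : ℤ) : ℝ) : UnitAddCircle) = 0 := by
    rw [AddCircle.coe_eq_zero_iff]
    exact ⟨q.num / q.den, by simp⟩
  rw [hz, sub_zero]

/-- The circle `ℝ/ℤ` with the arc length distance, and the classes of the rationals as ideal
points: `⟨a, c⟩ ↦ a / (c + 1)`. -/
noncomputable instance : ComputableMetricSpace UnitAddCircle where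
  complete := inferInstance
  idealPt n := (((n.unpair.1 : ℝ) / ((n.unpair.2 : ℝ) + 1) : ℝ) : UnitAddCircle)
  dense := dense_circle
  dist_lower := re_lower (δ := fun p : ℕ × ℕ =>
      dist (((p.1.unpair.1 : ℝ) / ((p.1.unpair.2 : ℝ) + 1) : ℝ) : UnitAddCircle)
        (((p.2.unpair.1 : ℝ) / ((p.2.unpair.2 : ℝ) + 1) : ℝ) : UnitAddCircle))
    primrec_circleNum primrec_denPred circle_dist_eq
  dist_upper := re_upper (δ := fun p : ℕ × ℕ =>
      dist (((p.1.unpair.1 : ℝ) / ((p.1.unpair.2 : ℝ) + 1) : ℝ) : UnitAddCircle)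
        (((p.2.unpair.1 : ℝ) / ((p.2.unpair.2 : ℝ) + 1) : ℝ) : UnitAddCircle))
    primrec_circleNum primrec_denPred circle_dist_eq

/-! ### The construction of the map -/

/-- The sets from which the map is built: nonempty recursively compact subsets of `[0, 1]`
without computable points. -/
structure IsSeedSet (K : Set ℝ) : Prop where
  subset : K ⊆ Icc 0 1
  nonempty : K.Nonempty
  recCompact : IsRecCompact K
  no_computable : ∀ x ∈ K, ¬ IsComputablePoint x

/-- The choices made in the construction: computable sequences with
`(0, 1) \ K = ⋃ i, (a i, b i)`, a rational margin `ε`, and nondecreasing, uniformly computable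
maps `f i` of `[0, 1]` to itself that move the points of `(a i, b i)` to the right and fix
all the others. -/
structure IsConstruction (K : Set ℝ) (a b : ℕ → ℝ) (ε : ℚ) (f : ℕ → ℝ → ℝ) : Prop where
  computable_a : IsComputableSeq a
  computable_b : IsComputableSeq b
  a_pos : ∀ i, 0 < a i
  a_lt_b : ∀ i, a i < b i
  b_lt_one : ∀ i, b i < 1
  cover : Ioo 0 1 \ K = ⋃ i, Ioo (a i) (b i)
  ε_pos : 0 < ε
  margin : K ⊆ Icc (ε : ℝ) (1 - ε)
  f_computable : UniformlyComputableOn f (Icc 0 1)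
  f_maps : ∀ i, MapsTo (f i) (Icc 0 1) (Icc 0 1)
  f_mono : ∀ i, MonotoneOn (f i) (Icc 0 1)
  f_moves : ∀ i, ∀ x ∈ Ioo (a i) (b i), x < f i x
  f_fixes : ∀ i, ∀ x ∈ Icc (0 : ℝ) 1, x ∉ Ioo (a i) (b i) → f i x = x

/-- The standard choice of the maps `f i`: slope two on the left half of `[a, b]`,
constantly `b` on the right half. -/
noncomputable def standardStep (a b : ℕ → ℝ) (i : ℕ) (x : ℝ) : ℝ :=
  if a i ≤ x ∧ x ≤ (a i + b i) / 2 then 2 * x - a i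
  else if (a i + b i) / 2 ≤ x ∧ x ≤ b i then b i
  else x

/-- The map `[0, 1] → ℝ` that moves only the points outside `[ε, 1 - ε]`. -/
noncomputable def outerMap (ε : ℚ) (x : ℝ) : ℝ :=
  if x ≤ ε then (ε : ℝ) else if x ≤ 1 - ε then x else 2 * x - (1 - ε)

/-- The map `[0, 1] → ℝ`, with total weight `1/2` on the `f i`. -/
noncomputable def liftMap (ε : ℚ) (f : ℕ → ℝ → ℝ) (x : ℝ) : ℝ :=
  outerMap ε x / 2 + ∑' i : ℕ, (1 / 2 : ℝ) ^ (i + 2) * f i x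

/-- The quotient map on the circle. -/
noncomputable def circleMap (ε : ℚ) (f : ℕ → ℝ → ℝ) : UnitAddCircle → UnitAddCircle :=
  AddCircle.liftIco (1 : ℝ) 0 fun x => (liftMap ε f x : UnitAddCircle)

end LabelBomb

/-! A seed set comes from diagonalization. From `[0,1]` remove, for each program `e` that on input
`e` returns an ideal ball of radius at most `2^(-e-3)`, that ball. The removed length is at most
`1/2`, so something remains. A computable point has a program giving, for each `k`, a ball of radius
at most `2^(-k-3)` around it; applied to its own number, this program removes the point. Covering
the remainder by finitely many balls means covering `[0,1]` by these balls and the removed ones,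
which a sufficiently fine rational grid detects (`isSeedSet_diagonalSet`). For any seed set,
recursive compactness enumerates the closed rational intervals in `(0,1)` that miss `K`, and these
give the standard data (`IsSeedSet.exists_isConstruction`).

The map moves the two ends of `[0,1]` by the same amount `ε/2`, so it has a continuous monotone lift
`lineMap` of degree one. Its displacement is nonnegative and vanishes exactly over `K`. Since a
monotone map cannot carry a point past a fixed point, every orbit of the lift travels at most
distance `1`. Integrating the sum of `n` displacements against an invariant measure gives `n * ∫ D ≤
1` for all `n`, whence `D = 0` almost everywhere and the measure lives on `K`
(`measure_compl_eq_zero`). Monotonicity also makes the map computable: an interval is mapped into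
another as soon as its endpoints are, so values at rationals suffice (`isComputableMap_circleMap`).

For a computable measure, the ideal balls of positive measure form an r.e. set
(`rePred_measure_pos`). Each contains arbitrarily small balls of positive measure, so a computable
nested sequence of them converges to a computable point of the support
(`exists_computable_mem_support`). An invariant computable measure would thus have a computable
point of `K mod 1` in its support. As `K` lies inside `(0,1)`, that point lifts to a computable real
in `K`, a contradiction. -/

namespace LabelBomb

/-! ### Recursively enumerable predicates -/

section RE

variable {α β : Type*} [Primcodable α] [Primcodable β]

theorem _root_.REPred.comp {p : β → Prop} (hp : REPred p) {f : α → β} (hf : Computable f)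
    {q : α → Prop} (h : ∀ a, q a ↔ p (f a) := by exact fun _ => Iff.rfl) : REPred q :=
  REPred.of_eq (p := fun a => p (f a)) (Partrec.comp hp hf) fun a => (h a).symm

/-- Running one semi-decision after the other halts exactly when both do. -/
theorem _root_.REPred.and {p q : α → Prop} (hp : REPred p) (hq : REPred q) :
    REPred fun a => p a ∧ q a := by
  have h : Partrec fun a => (Part.assert (p a) fun _ => Part.some ()).bind
      fun _ => (Part.assert (q a) fun _ => Part.some ()) :=
    Partrec.bind hp (Partrec.to₂ (Partrec.comp hq Computable.fst))
  exact h.dom_re.of_eq fun a => by simp [Part.assert, Part.bind]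

theorem _root_.REPred.or {p q : α → Prop} (hp : REPred p) (hq : REPred q) :
    REPred fun a => p a ∨ q a := by
  obtain ⟨k, hk, h⟩ := Partrec.merge' hp hq
  exact hk.dom_re.of_eq fun a => by rw [(h a).2]; simp [Part.assert]

/-- An r.e. predicate is the projection of a computable one. -/
theorem _root_.REPred.exists_stage {p : α → Prop} (hp : REPred p) :
    ∃ Q : α → ℕ → Bool, Computable₂ Q ∧ ∀ a, p a ↔ ∃ n, Q a n = true := by
  obtain ⟨c, hc⟩ := Nat.Partrec.Code.exists_code.1 hp
  -- The stage is the resource bound of `evaln`, which makes the halting test primitive recursive.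
  refine ⟨fun a k => (Nat.Partrec.Code.evaln k c (Encodable.encode a)).isSome, ?_, fun a => ?_⟩
  · have h : Primrec fun x : α × ℕ =>
        (Nat.Partrec.Code.evaln x.2 c (Encodable.encode x.1)).isSome :=
      Primrec.option_isSome.comp (Nat.Partrec.Code.primrec_evaln.comp
        (((Primrec.snd).pair (Primrec.const c)).pair (Primrec.encode.comp Primrec.fst)))
    exact h.to_comp
  · have h1 : p a ↔ (Nat.Partrec.Code.eval c (Encodable.encode a)).Dom := by
      rw [hc]; simp [Part.assert]
    rw [h1, Part.dom_iff_mem]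
    simp only [Nat.Partrec.Code.evaln_complete, Option.isSome_iff_exists, Option.mem_def]
    exact exists_comm

/-- Dovetailing: one unbounded search runs over pairs of a witness and a stage at which it is
confirmed. -/
theorem _root_.REPred.exists_nat {p : α × ℕ → Prop} (hp : REPred p) :
    REPred fun a => ∃ n, p (a, n) := by
  obtain ⟨Q, hQ, h⟩ := REPred.exists_stage hp
  have hc : Computable₂ fun (a : α) (m : ℕ) => Q (a, m.unpair.1) m.unpair.2 := by
    have hu : Computable fun x : α × ℕ => x.2.unpair := Computable.unpair.comp Computable.snd
    exact Computable₂.comp hQ (Computable.fst.pair (Computable.fst.comp hu))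
      (Computable.snd.comp hu)
  have hr := (Partrec.rfind (p := fun a m => Part.some (Q (a, m.unpair.1) m.unpair.2))
    hc.partrec₂).dom_re
  refine hr.of_eq fun a => Nat.rfind_dom.trans ?_
  simp only [h]
  constructor
  · rintro ⟨m, hm, -⟩
    exact ⟨_, _, by simpa using hm⟩
  · rintro ⟨n, m, hm⟩
    exact ⟨Nat.pair n m, by simpa using hm, fun _ => trivial⟩

theorem _root_.REPred.exists {p : α × β → Prop} (hp : REPred p) :
    REPred fun a => ∃ b, p (a, b) := by
  have h : Partrec fun x : α × ℕ => ((Encodable.decode x.2 : Option β) : Part β).bind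
      fun b => Part.assert (p (x.1, b)) fun _ => Part.some () :=
    Partrec.bind (Computable.decode.comp Computable.snd).ofOption
      (Partrec.to₂ (Partrec.comp hp
        ((Computable.fst.comp Computable.fst).pair Computable.snd)))
  refine (REPred.exists_nat h.dom_re).of_eq fun a => ?_
  simp only [Part.dom_iff_mem, Part.mem_bind_iff, Part.mem_ofOption, Part.mem_assert_iff]
  constructor
  · rintro ⟨n, _, b, -, hb, -⟩
    exact ⟨b, hb⟩
  · rintro ⟨b, hb⟩
    exact ⟨Encodable.encode b, (), b, by simp, hb, by simp⟩

/-- A primitive recursion performs the `N a` semi-decisions one after the other; it halts exactly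
when all of them do. -/
theorem _root_.REPred.forall_lt {p : α × ℕ → Prop} (hp : REPred p) {N : α → ℕ} (hN : Computable N) :
    REPred fun a => ∀ k < N a, p (a, k) := by
  have h := Partrec.nat_rec (f := N) (g := fun _ : α => Part.some ())
    (h := fun a x => Part.assert (p (a, x.1)) fun _ => Part.some ()) hN
    (Computable.const ()).partrec
    (Partrec.to₂ (Partrec.comp hp
        (Computable.fst.pair (Computable.fst.comp Computable.snd))))
  refine h.dom_re.of_eq fun a => ?_
  generalize N a = n
  induction n with
  | zero => simp
  | succ n ih =>
    rw [Nat.forall_lt_succ_right, ← ih]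
    simp [Part.assert, Part.bind]

/-- Uniformization of a total r.e. relation by a computable function. -/
theorem _root_.REPred.exists_computable {R : α × ℕ → Prop} (hR : REPred R) (h : ∀ a, ∃ n, R (a, n)) :
    ∃ f : α → ℕ, Computable f ∧ ∀ a, R (a, f a) := by
  obtain ⟨Q, hQ, hQR⟩ := REPred.exists_stage hR
  have hex : ∀ a : α, ∃ m : ℕ, Q (a, m.unpair.1) m.unpair.2 = true := by
    intro a
    obtain ⟨n, hn⟩ := h a
    obtain ⟨m, hm⟩ := (hQR _).1 hn
    exact ⟨Nat.pair n m, by simpa using hm⟩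
  have hc : ComputablePred fun x : α × ℕ => Q (x.1, x.2.unpair.1) x.2.unpair.2 = true := by
    have hu : Computable fun x : α × ℕ => x.2.unpair := Computable.unpair.comp Computable.snd
    have := Computable₂.comp hQ (Computable.fst.pair (Computable.fst.comp hu))
      (Computable.snd.comp hu)
    exact Computable.computablePred (this.of_eq fun a => by simp)
  refine ⟨_, Computable.fst.comp (Computable.unpair.comp (Computable.find hc hex)), fun a => ?_⟩
  exact (hQR _).2 ⟨_, Nat.find_spec (hex a)⟩

/-- A nonempty r.e. set of numbers is the range of a computable function. -/
theorem _root_.REPred.exists_enumeration {p : ℕ → Prop} (hp : REPred p) (hne : ∃ n, p n) :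
    ∃ f : ℕ → ℕ, Computable f ∧ ∀ n, p n ↔ ∃ m, f m = n := by
  obtain ⟨n₀, h₀⟩ := hne
  obtain ⟨Q, hQ, h⟩ := REPred.exists_stage hp
  have hu : Computable fun x : ℕ => x.unpair := Computable.unpair
  -- Indices whose stage confirms nothing are sent to the known member `n₀`, so the enumeration is
  -- total.
  refine ⟨fun m => cond (Q m.unpair.1 m.unpair.2) m.unpair.1 n₀,
    Computable.cond (Computable₂.comp hQ (Computable.fst.comp hu) (Computable.snd.comp hu))
      (Computable.fst.comp hu) (Computable.const n₀), fun n => ⟨fun hn => ?_, ?_⟩⟩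
  · obtain ⟨m, hm⟩ := (h n).1 hn
    exact ⟨Nat.pair n m, by simp [hm]⟩
  · rintro ⟨m, rfl⟩
    cases hm : Q m.unpair.1 m.unpair.2
    · simpa [hm] using h₀
    · simpa [hm] using (h _).2 ⟨_, hm⟩

end RE

/-! ### Computable functions with rational values -/

section CompQ

variable {α β : Type*} [Primcodable α] [Primcodable β]

/-- A rational valued function is computable if its values have computable codes. -/
def CompQ (F : α → ℚ) : Prop := ∃ g : α → ℕ, Computable g ∧ ∀ a, F a = ratOfCode (g a)

theorem _root_.Computable.natAdd {A B : α → ℕ} (hA : Computable A) (hB : Computable B) :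
    Computable fun a => A a + B a := Computable₂.comp Primrec.nat_add.to_comp hA hB

theorem _root_.Computable.natMul {A B : α → ℕ} (hA : Computable A) (hB : Computable B) :
    Computable fun a => A a * B a := Computable₂.comp Primrec.nat_mul.to_comp hA hB

theorem _root_.Computable.natPair {A B : α → ℕ} (hA : Computable A) (hB : Computable B) :
    Computable fun a => Nat.pair (A a) (B a) := Computable₂.comp Primrec₂.natPair.to_comp hA hB

/-- With `exists_frac`, this reduces rational arithmetic to arithmetic of natural numbers; the form
`C + 1` keeps denominators positive. -/
theorem CompQ.of_frac {A B C : α → ℕ} (hA : Computable A) (hB : Computable B) (hC : Computable C) :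
    CompQ fun a => ((A a : ℚ) - B a) / (C a + 1) :=
  ⟨_, Computable.natPair (Computable.natPair hA hB) hC, fun a => by simp [ratOfCode]⟩

theorem CompQ.exists_frac {F : α → ℚ} (hF : CompQ F) : ∃ A B C : α → ℕ, Computable A ∧
    Computable B ∧ Computable C ∧ ∀ a, F a = ((A a : ℚ) - B a) / (C a + 1) := by
  obtain ⟨g, hg, h⟩ := hF
  have hu := Computable.unpair.comp hg
  have hv := Computable.unpair.comp (Computable.fst.comp hu)
  exact ⟨_, _, _, Computable.fst.comp hv, Computable.snd.comp hv, Computable.snd.comp hu, h⟩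

theorem CompQ.of_eq {F G : α → ℚ} (hF : CompQ F) (h : ∀ a, F a = G a) : CompQ G :=
  (funext h : F = G) ▸ hF

theorem CompQ.comp {F : β → ℚ} (hF : CompQ F) {f : α → β} (hf : Computable f)
    {G : α → ℚ} (hG : ∀ a, G a = F (f a) := by exact fun _ => rfl) : CompQ G := by
  obtain ⟨g, hg, h⟩ := hF
  exact ⟨_, hg.comp hf, fun a => (hG a).trans (h _)⟩

theorem compQ_ratOfCode : CompQ ratOfCode := ⟨_, Computable.id, fun _ => rfl⟩

theorem CompQ.nat {A : α → ℕ} (hA : Computable A) : CompQ fun a => (A a : ℚ) :=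
  (CompQ.of_frac hA (Computable.const 0) (Computable.const 0)).of_eq fun a => by simp

theorem CompQ.const (q : ℚ) : CompQ fun _ : α => q := by
  obtain ⟨n, rfl⟩ := ratOfCode_surjective q
  exact ⟨_, Computable.const n, fun _ => rfl⟩

theorem CompQ.neg {F : α → ℚ} (hF : CompQ F) : CompQ fun a => - F a := by
  obtain ⟨A, B, C, hA, hB, hC, h⟩ := hF.exists_frac
  exact (CompQ.of_frac hB hA hC).of_eq fun a => by rw [h]; ring

theorem CompQ.add {F G : α → ℚ} (hF : CompQ F) (hG : CompQ G) : CompQ fun a => F a + G a := by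
  obtain ⟨A, B, C, hA, hB, hC, h⟩ := hF.exists_frac
  obtain ⟨A', B', C', hA', hB', hC', h'⟩ := hG.exists_frac
  refine (CompQ.of_frac
    ((hA.natMul (Computable.succ.comp hC')).natAdd (hA'.natMul (Computable.succ.comp hC)))
    ((hB.natMul (Computable.succ.comp hC')).natAdd (hB'.natMul (Computable.succ.comp hC)))
    (((hC.natMul hC').natAdd hC).natAdd hC')).of_eq fun a => ?_
  have e : ((C a : ℚ) * C' a + C a + C' a + 1) = (C a + 1) * (C' a + 1) := by ring
  rw [h, h']
  push_cast
  rw [e]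
  field_simp
  ring

theorem CompQ.mul {F G : α → ℚ} (hF : CompQ F) (hG : CompQ G) : CompQ fun a => F a * G a := by
  obtain ⟨A, B, C, hA, hB, hC, h⟩ := hF.exists_frac
  obtain ⟨A', B', C', hA', hB', hC', h'⟩ := hG.exists_frac
  refine (CompQ.of_frac ((hA.natMul hA').natAdd (hB.natMul hB')) ((hA.natMul hB').natAdd (hB.natMul hA'))
    (((hC.natMul hC').natAdd hC).natAdd hC')).of_eq fun a => ?_
  have e : ((C a : ℚ) * C' a + C a + C' a + 1) = (C a + 1) * (C' a + 1) := by ring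
  rw [h, h']
  push_cast
  rw [e]
  field_simp
  ring

theorem CompQ.sub {F G : α → ℚ} (hF : CompQ F) (hG : CompQ G) : CompQ fun a => F a - G a :=
  (hF.add hG.neg).of_eq fun _ => (sub_eq_add_neg _ _).symm

theorem CompQ.lt {F G : α → ℚ} (hF : CompQ F) (hG : CompQ G) :
    ComputablePred fun a => F a < G a := by
  obtain ⟨A, B, C, hA, hB, hC, h⟩ := (hG.sub hF).exists_frac
  have : Computable fun a => decide (B a < A a) :=
    Computable₂.comp Primrec.nat_lt.decide.to_comp hB hA
  refine (Computable.computablePred this).of_eq fun a => ?_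
  rw [← sub_pos (a := G a), h, div_pos_iff_of_pos_right (by positivity), sub_pos, Nat.cast_lt]

theorem CompQ.le {F G : α → ℚ} (hF : CompQ F) (hG : CompQ G) :
    ComputablePred fun a => F a ≤ G a :=
  (hG.lt hF).not.of_eq fun _ => not_lt

theorem CompQ.ite {F G : α → ℚ} (hF : CompQ F) (hG : CompQ G) {c : α → Prop} [DecidablePred c]
    (hc : ComputablePred c) : CompQ fun a => if c a then F a else G a := by
  obtain ⟨f, hf, h⟩ := hF
  obtain ⟨g, hg, h'⟩ := hG
  refine ⟨_, Computable.cond hc.decide hf hg, fun a => ?_⟩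
  by_cases hca : c a <;> simp [hca, h, h']

theorem CompQ.max {F G : α → ℚ} (hF : CompQ F) (hG : CompQ G) :
    CompQ fun a => max (F a) (G a) :=
  (hG.ite hF (hF.le hG)).of_eq fun _ => (max_def _ _).symm

theorem CompQ.min {F G : α → ℚ} (hF : CompQ F) (hG : CompQ G) :
    CompQ fun a => min (F a) (G a) :=
  (hF.ite hG (hF.le hG)).of_eq fun _ => (min_def _ _).symm

theorem CompQ.abs {F : α → ℚ} (hF : CompQ F) : CompQ fun a => |F a| :=
  (hF.max hF.neg).of_eq fun _ => rfl

theorem compQ_posRatOfCode : CompQ posRatOfCode := by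
  refine (CompQ.of_frac (A := fun n => n.unpair.1 + 1) (B := fun _ => 0)
    (C := fun n => n.unpair.2)
    (Computable.natAdd (A := fun n : ℕ => n.unpair.1)
      (Computable.fst.comp Computable.unpair) (Computable.const 1))
    (Computable.const 0)
    (Computable.snd.comp Computable.unpair)).of_eq fun n => by simp [posRatOfCode]

theorem CompQ.sum_range {F : α × ℕ → ℚ} (hF : CompQ F) {N : α → ℕ} (hN : Computable N) :
    CompQ fun a => ∑ k ∈ Finset.range (N a), F (a, k) := by
  obtain ⟨z, hz⟩ := ratOfCode_surjective 0
  -- `s` takes an index and the code of a partial sum to the code of the next partial sum; it is the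
  -- step of the recursion.
  obtain ⟨s, hs, h⟩ := (compQ_ratOfCode.comp (Computable.snd (α := α × ℕ) (β := ℕ))).add
    (hF.comp (Computable.fst (α := α × ℕ) (β := ℕ)))
  have hc := Computable.nat_rec (f := N) (g := fun _ : α => z)
    (h := fun a x => s ((a, x.1), x.2)) hN (Computable.const z)
    (hs.comp ((Computable.fst.pair (Computable.fst.comp Computable.snd)).pair
      (Computable.snd.comp Computable.snd)))
  refine ⟨_, hc, fun a => ?_⟩
  beta_reduce
  generalize N a = n
  induction n with
  | zero => simp [hz]
  | succ n ih =>
    rw [Finset.sum_range_succ, ih]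
    simpa using h ((a, n), _)

theorem CompQ.half_pow {k : α → ℕ} (hk : Computable k) : CompQ fun a => (1 / 2 : ℚ) ^ k a := by
  obtain ⟨s, hs, h⟩ := (CompQ.const (1 / 2)).mul compQ_ratOfCode
  obtain ⟨z, hz⟩ := ratOfCode_surjective 1
  have key : ∀ n : ℕ, (1 / 2 : ℚ) ^ n = ratOfCode (Nat.rec z (fun _ c => s c) n) := by
    intro n
    induction n with
    | zero => simp [hz]
    | succ n ih =>
      rw [pow_succ', ih]
      exact h _
  exact ⟨_, Computable.nat_rec (f := k) (g := fun _ => z) (h := fun _ x => s x.2) hk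
    (Computable.const z) (hs.comp (Computable.snd.comp Computable.snd)), fun a => key _⟩

theorem posRatOfCode_pos (n : ℕ) : 0 < posRatOfCode n := by
  unfold posRatOfCode
  positivity

theorem exists_posRatOfCode {q : ℚ} (hq : 0 < q) : ∃ n, posRatOfCode n = q := by
  refine ⟨Nat.pair (q.num.toNat - 1) (q.den - 1), ?_⟩
  have hn : 0 < q.num := Rat.num_pos.2 hq
  have h1 : (((q.num.toNat - 1 : ℕ) : ℚ) + 1) = q.num := by
    have : (((q.num.toNat - 1 : ℕ) : ℤ) + 1) = q.num := by omega
    exact_mod_cast this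
  have h2 : (((q.den - 1 : ℕ) : ℚ) + 1) = q.den := by
    have := q.pos
    have h : q.den - 1 + 1 = q.den := by omega
    exact_mod_cast h
  simp only [posRatOfCode, Nat.unpair_pair]
  rw [h1, h2, Rat.num_div_den]

end CompQ

/-! ### Ideal balls -/

/-! ### Rational approximation of reals with r.e. cuts -/

section Approximation

variable {α : Type*} [Primcodable α]

theorem _root_.REPred.lt_compQ {F : α → ℝ} (hF : REPred fun p : α × ℕ => F p.1 < (ratOfCode p.2 : ℝ))
    {G : α → ℚ} (hG : CompQ G) : REPred fun a => F a < (G a : ℝ) := by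
  obtain ⟨g, hg, h⟩ := hG
  exact REPred.comp hF (Computable.id.pair hg) fun a => by simp [h]

/-- Real numbers with uniformly r.e. cuts have uniformly computable rational approximations. -/
theorem exists_approx {F : α → ℝ} (hl : REPred fun p : α × ℕ => (ratOfCode p.2 : ℝ) < F p.1)
    (hu : REPred fun p : α × ℕ => F p.1 < (ratOfCode p.2 : ℝ)) :
    ∃ D : α × ℕ → ℚ, CompQ D ∧ ∀ a k, |F a - D (a, k)| < (1 / 2 : ℝ) ^ k := by
  have hq : CompQ fun x : (α × ℕ) × ℕ => ratOfCode x.2 := compQ_ratOfCode.comp Computable.snd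
  have ha : Computable fun x : (α × ℕ) × ℕ => x.1.1 := Computable.fst.comp Computable.fst
  have h1 : REPred fun x : (α × ℕ) × ℕ => (ratOfCode x.2 : ℝ) < F x.1.1 :=
    REPred.comp hl (ha.pair Computable.snd)
  have h2 : REPred fun x : (α × ℕ) × ℕ =>
      F x.1.1 < ((ratOfCode x.2 + (1 / 2 : ℚ) ^ x.1.2 : ℚ) : ℝ) :=
    REPred.lt_compQ (F := fun x : (α × ℕ) × ℕ => F x.1.1)
      (REPred.comp hu ((ha.comp Computable.fst).pair Computable.snd))
      (hq.add (CompQ.half_pow (Computable.snd.comp Computable.fst)))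
  -- Search for a rational `q` with `q < F < q + 2^(-k)`.
  obtain ⟨f, hf, h⟩ := REPred.exists_computable (h1.and h2) fun x => by
    obtain ⟨q, hq1, hq2⟩ := exists_rat_btwn
      (show F x.1 - (1 / 2 : ℝ) ^ x.2 < F x.1 from sub_lt_self _ (by positivity))
    obtain ⟨n, rfl⟩ := ratOfCode_surjective q
    refine ⟨n, hq2, ?_⟩
    push_cast
    linarith
  refine ⟨fun x => ratOfCode (f x), compQ_ratOfCode.comp hf, fun a k => ?_⟩
  obtain ⟨h1, h2⟩ := h (a, k)
  push_cast at h2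
  rw [abs_lt]
  constructor <;> linarith [show (0 : ℝ) < (1 / 2 : ℝ) ^ k by positivity]

end Approximation

/-! ### Formal inclusion of ideal balls and computable limit points -/

section IdealBalls

/-- The radius of the ideal ball with number `n`. -/
def ballRadius (n : ℕ) : ℚ := posRatOfCode n.unpair.2

theorem ballRadius_pos (n : ℕ) : 0 < ballRadius n := posRatOfCode_pos _

theorem ballRadius_pos' (n : ℕ) : (0 : ℝ) < ballRadius n := by
  exact_mod_cast ballRadius_pos n

theorem compQ_ballRadius : CompQ ballRadius :=
  compQ_posRatOfCode.comp (Computable.snd.comp Computable.unpair)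

variable (X : Type*) [MetricSpace X] [ComputableMetricSpace X]

/-- The centre of the ideal ball with number `n`. -/
def ballCenter (n : ℕ) : X := ComputableMetricSpace.idealPt n.unpair.1

variable {X}

theorem mem_idealBall {x : X} {n : ℕ} :
    x ∈ idealBall X n ↔ dist x (ballCenter X n) < (ballRadius n : ℝ) := Iff.rfl

theorem isOpen_idealBall (n : ℕ) : IsOpen (idealBall X n) := Metric.isOpen_ball

variable (X) in
/-- Formal inclusion of the ideal ball `m` in the ideal ball `n`. -/
def FormallyInside (m n : ℕ) : Prop :=
  dist (ballCenter X m) (ballCenter X n) + ballRadius m < ballRadius n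

theorem FormallyInside.subset {m n : ℕ} (h : FormallyInside X m n) :
    idealBall X m ⊆ idealBall X n := by
  intro x hx
  rw [mem_idealBall] at *
  unfold FormallyInside at h
  linarith [dist_triangle x (ballCenter X m) (ballCenter X n)]

/-- Formal inclusion is a strict upper bound on a distance, hence semi-decidable; it replaces
inclusion of sets in all the searches below. -/
theorem rePred_formallyInside : REPred fun p : ℕ × ℕ => FormallyInside X p.1 p.2 := by
  have hu1 : Computable fun p : ℕ × ℕ => p.1.unpair.1 :=
    Computable.fst.comp (Computable.unpair.comp Computable.fst)
  have hu2 : Computable fun p : ℕ × ℕ => p.2.unpair.1 :=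
    Computable.fst.comp (Computable.unpair.comp Computable.snd)
  have h := REPred.lt_compQ (F := fun p : ℕ × ℕ => dist (ballCenter X p.1) (ballCenter X p.2))
    (REPred.comp (ComputableMetricSpace.dist_upper (X := X))
      (((hu1.comp Computable.fst).pair (hu2.comp Computable.fst)).pair Computable.snd))
    ((compQ_ballRadius.comp Computable.snd).sub (compQ_ballRadius.comp Computable.fst))
  refine h.of_eq fun p => ?_
  unfold FormallyInside
  push_cast
  exact lt_sub_iff_add_lt

theorem exists_mem_idealBall_radius_lt (x : X) {δ : ℝ} (hδ : 0 < δ) :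
    ∃ n, x ∈ idealBall X n ∧ (ballRadius n : ℝ) < δ := by
  obtain ⟨q, hq0, hqδ⟩ := exists_rat_btwn hδ
  have hq0' : (0 : ℚ) < q := by exact_mod_cast hq0
  obtain ⟨j, rfl⟩ := exists_posRatOfCode hq0'
  obtain ⟨i, hi⟩ := (ComputableMetricSpace.dense (X := X)).exists_dist_lt x hq0
  exact ⟨Nat.pair i j, by simpa [mem_idealBall, ballCenter, ballRadius] using hi,
    by simpa [ballRadius] using hqδ⟩

theorem exists_formallyInside {x : X} {n : ℕ} (hx : x ∈ idealBall X n) {δ : ℝ} (hδ : 0 < δ) :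
    ∃ m, x ∈ idealBall X m ∧ FormallyInside X m n ∧ (ballRadius m : ℝ) < δ := by
  rw [mem_idealBall] at hx
  obtain ⟨m, hm, hr⟩ := exists_mem_idealBall_radius_lt x
    (lt_min hδ (half_pos (sub_pos.2 hx)))
  refine ⟨m, hm, ?_, hr.trans_le (min_le_left _ _)⟩
  have hr' := hr.trans_le (min_le_right _ _)
  rw [mem_idealBall] at hm
  unfold FormallyInside
  linarith [dist_triangle_left (ballCenter X m) (ballCenter X n) x]

/-- The intersection point of a computable sequence of shrinking, formally nested ideal balls is
computable. -/
theorem exists_computable_limit {n : ℕ → ℕ} (hn : Computable n)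
    (h : ∀ k, FormallyInside X (n (k + 1)) (n k))
    (hr : ∀ k, ballRadius (n (k + 1)) < ballRadius (n k) / 2) :
    ∃ x : X, IsComputablePoint x ∧ (∀ k, x ∈ idealBall X (n k)) ∧
      Filter.Tendsto (fun k => (ballRadius (n k) : ℝ)) Filter.atTop (nhds 0) := by
  have hgeo : ∀ k, (ballRadius (n k) : ℝ) ≤ ballRadius (n 0) * (1 / 2 : ℝ) ^ k := by
    intro k
    induction k with
    | zero => simp
    | succ k ih =>
      have := hr k
      have h' : (ballRadius (n (k + 1)) : ℝ) < ballRadius (n k) / 2 := by exact_mod_cast this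
      rw [pow_succ]
      linarith
  have hlim : Filter.Tendsto (fun k => (ballRadius (n k) : ℝ)) Filter.atTop (nhds 0) := by
    refine squeeze_zero (fun k => (ballRadius_pos' _).le) hgeo ?_
    simpa using (tendsto_pow_atTop_nhds_zero_of_lt_one (r := (1 / 2 : ℝ))
      (by norm_num) (by norm_num)).const_mul (ballRadius (n 0) : ℝ)
  have hd : ∀ k, dist (ballCenter X (n k)) (ballCenter X (n (k + 1))) ≤
      ballRadius (n 0) * (1 / 2 : ℝ) ^ k := by
    intro k
    have := h k
    unfold FormallyInside at this
    rw [dist_comm]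
    linarith [hgeo k, ballRadius_pos' (n (k + 1))]
  have := ComputableMetricSpace.complete (X := X)
  obtain ⟨x, hx⟩ := cauchySeq_tendsto_of_complete
    (cauchySeq_of_le_geometric (1 / 2 : ℝ) _ (by norm_num) hd)
  have hnest : ∀ k j, idealBall X (n (k + j)) ⊆ idealBall X (n k) := by
    intro k j
    induction j with
    | zero => exact subset_rfl
    | succ j ih => exact (h (k + j)).subset.trans ih
  have hle : ∀ k, dist x (ballCenter X (n k)) ≤ ballRadius (n k) := by
    intro k
    refine le_of_tendsto (hx.dist tendsto_const_nhds) (Filter.eventually_atTop.2 ⟨k, ?_⟩)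
    intro j hj
    obtain ⟨i, rfl⟩ := Nat.exists_eq_add_of_le hj
    exact (mem_idealBall.1 (hnest k i (by simpa [mem_idealBall] using ballRadius_pos _))).le
  -- The limit is only known to lie in closed balls; the strict inequality in the formal inclusion
  -- of the next ball puts it in the open one.
  have hmem : ∀ k, x ∈ idealBall X (n k) := by
    intro k
    have h1 := h k
    have h2 := hle (k + 1)
    unfold FormallyInside at h1
    rw [mem_idealBall]
    linarith [dist_triangle x (ballCenter X (n (k + 1))) (ballCenter X (n k))]
  refine ⟨x, ?_, hmem, hlim⟩
  -- A ball contains the limit exactly when some ball of the sequence lies formally inside it.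
  have hre : REPred fun m => ∃ k, FormallyInside X (n k) m :=
    REPred.exists_nat (p := fun p : ℕ × ℕ => FormallyInside X (n p.2) p.1)
      (REPred.comp rePred_formallyInside ((hn.comp Computable.snd).pair Computable.fst))
  refine hre.of_eq fun m => ⟨fun ⟨k, hk⟩ => hk.subset (hmem k), fun hm => ?_⟩
  rw [mem_idealBall] at hm
  obtain ⟨k, hk⟩ := (hlim.eventually (gt_mem_nhds (half_pos (sub_pos.2 hm)))).exists
  refine ⟨k, ?_⟩
  unfold FormallyInside
  linarith [dist_triangle_left (ballCenter X (n k)) (ballCenter X m) x, hle k]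

/-- If the r.e. set `P` of ideal balls is nonempty and each of its members formally contains
arbitrarily small members, then some computable point has small neighbourhoods in `P`. -/
theorem exists_computable_point_of_rePred {P : ℕ → Prop} (hP : REPred P) (hne : ∃ n, P n)
    (hstep : ∀ n, P n → ∃ m, P m ∧ FormallyInside X m n ∧ ballRadius m < ballRadius n / 2) :
    ∃ x : X, IsComputablePoint x ∧ ∀ U ∈ nhds x, ∃ n, P n ∧ idealBall X n ⊆ U := by
  obtain ⟨f, hf, hfP⟩ := REPred.exists_enumeration hP hne
  have hre : REPred fun p : ℕ × ℕ => FormallyInside X (f p.2) (f p.1) ∧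
      ballRadius (f p.2) < ballRadius (f p.1) / 2 := by
    refine REPred.and (REPred.comp (rePred_formallyInside (X := X))
      ((hf.comp Computable.snd).pair (hf.comp Computable.fst))) ?_
    have h := CompQ.lt (compQ_ballRadius.comp (hf.comp (Computable.snd (α := ℕ) (β := ℕ))))
      ((compQ_ballRadius.comp (hf.comp (Computable.fst (α := ℕ) (β := ℕ)))).mul
        (CompQ.const (1 / 2)))
    exact h.to_re.of_eq fun p => by rw [mul_one_div]
  obtain ⟨g, hg, hgR⟩ := REPred.exists_computable hre fun a => by
    obtain ⟨m, hm, h⟩ := hstep (f a) ((hfP _).2 ⟨a, rfl⟩)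
    obtain ⟨b, rfl⟩ := (hfP _).1 hm
    exact ⟨b, h⟩
  -- `g` picks the index of a smaller ball formally inside the current one; iterating it from index
  -- `0` yields the nested sequence.
  have hs : Computable fun k : ℕ => f (Nat.rec 0 (fun _ c => g c) k) :=
    hf.comp (Computable.nat_rec (f := fun k : ℕ => k) (g := fun _ => 0) (h := fun _ x => g x.2)
      Computable.id (Computable.const 0) (hg.comp (Computable.snd.comp Computable.snd)))
  obtain ⟨x, hx, hmem, hlim⟩ := exists_computable_limit (X := X) hs
    (fun k => (hgR _).1) (fun k => (hgR _).2)
  refine ⟨x, hx, fun U hU => ?_⟩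
  obtain ⟨δ, hδ, hball⟩ := Metric.mem_nhds_iff.1 hU
  obtain ⟨k, hk⟩ := (hlim.eventually (gt_mem_nhds (half_pos hδ))).exists
  refine ⟨f (Nat.rec 0 (fun _ c => g c) k), (hfP _).2 ⟨_, rfl⟩, fun y hy => hball ?_⟩
  have h1 := mem_idealBall.1 hy
  have h2 := mem_idealBall.1 (hmem k)
  rw [Metric.mem_ball]
  linarith [dist_triangle_right y x (ballCenter X (f (Nat.rec 0 (fun _ c => g c) k)))]

end IdealBalls

/-! ### The support of a computable measure -/

section Hat

variable {X : Type*} [MetricSpace X]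

/-- The hat function of a ball: the distance to the complement, for the formal ball. -/
noncomputable def hat (s : X) (r : ℝ) (x : X) : ℝ := max 0 (r - dist x s)

theorem hat_nonneg (s : X) (r : ℝ) (x : X) : 0 ≤ hat s r x := le_max_left _ _

theorem hat_pos_iff {s : X} {r : ℝ} {x : X} : 0 < hat s r x ↔ x ∈ Metric.ball s r := by
  simp [hat]

theorem lipschitz_hat (s : X) (r : ℝ) : LipschitzWith 1 (hat s r) := by
  refine LipschitzWith.of_le_add fun x y => ?_
  unfold hat
  rcases le_total 0 (r - dist x s) with h | h
  · rw [max_eq_right h]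
    linarith [le_max_right 0 (r - dist y s), dist_triangle y x s, dist_comm x y]
  · rw [max_eq_left h]
    linarith [le_max_left 0 (r - dist y s), dist_nonneg (x := x) (y := y)]

theorem abs_integral_sub_lt [BoundedSpace X] [MeasurableSpace X] {μ ν : Measure X} {f : X → ℝ}
    (hf : LipschitzWith 1 f) {δ : ℝ} (h : W₁ μ ν < ENNReal.ofReal δ) :
    |∫ x, f x ∂μ - ∫ x, f x ∂ν| < δ := by
  have h1 : ENNReal.ofReal |∫ x, f x ∂μ - ∫ x, f x ∂ν| < ENNReal.ofReal δ :=
    lt_of_le_of_lt (le_iSup₂ (f := fun (f : X → ℝ) (_ : LipschitzWith 1 f) =>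
      ENNReal.ofReal |∫ x, f x ∂μ - ∫ x, f x ∂ν|) f hf) h
  exact (ENNReal.ofReal_lt_ofReal_iff_of_nonneg (abs_nonneg _)).1 h1

end Hat

/-- This puts integrals against ideal measures into the form handled by `CompQ.sum_range`. The
default `(0, 0)` is never read. -/
theorem list_sum_eq_range {M : Type*} [AddCommMonoid M] (l : List (ℕ × ℕ)) (F : ℕ × ℕ → M) :
    (l.map F).sum = ∑ i ∈ Finset.range l.length, F (l.getD i (0, 0)) := by
  induction l with
  | nil => simp
  | cons p l ih =>
    rw [List.map_cons, List.sum_cons, ih, List.length_cons, Finset.sum_range_succ', add_comm]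
    simp

theorem totalWeight_eq (l : List (ℕ × ℕ)) :
    totalWeight l = ∑ i ∈ Finset.range l.length, ((l.getD i (0, 0)).2 + 1) :=
  list_sum_eq_range l _

theorem totalWeight_pos (p : ℕ × ℕ) (l : List (ℕ × ℕ)) : 0 < totalWeight (p :: l) := by
  simp [totalWeight]

/-! ### Positive measure of ideal balls and computable points of the support -/

section ComputableMeasure

variable {X : Type*} [MetricSpace X] [ComputableMetricSpace X]

theorem exists_dist_approx : ∃ D : (ℕ × ℕ) × ℕ → ℚ, CompQ D ∧ ∀ i j k,
    |dist (ComputableMetricSpace.idealPt i : X) (ComputableMetricSpace.idealPt j) - D ((i, j), k)|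
      < (1 / 2 : ℝ) ^ k := by
  obtain ⟨D, hD, h⟩ := exists_approx
    (F := fun p : ℕ × ℕ => dist (ComputableMetricSpace.idealPt p.1 : X)
      (ComputableMetricSpace.idealPt p.2)) (ComputableMetricSpace.dist_lower (X := X))
    (ComputableMetricSpace.dist_upper (X := X))
  exact ⟨D, hD, fun i j k => h (i, j) k⟩

theorem secondCountable_of_computable : SecondCountableTopology X := by
  have : TopologicalSpace.SeparableSpace X :=
    ⟨⟨range ComputableMetricSpace.idealPt, countable_range _, ComputableMetricSpace.dense⟩⟩
  exact UniformSpace.secondCountable_of_separable X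

variable [MeasurableSpace X]

theorem isFiniteMeasure_sum_dirac (l : List (ℕ × ℕ)) :
    IsFiniteMeasure (l.map fun p => ((p.2 + 1 : ℕ) : ℝ≥0∞) •
      Measure.dirac (ComputableMetricSpace.idealPt p.1 : X)).sum := by
  induction l with
  | nil => simpa using (inferInstance : IsFiniteMeasure (0 : Measure X))
  | cons p l ih =>
    rw [List.map_cons, List.sum_cons]
    have : IsFiniteMeasure (((p.2 + 1 : ℕ) : ℝ≥0∞) •
        Measure.dirac (ComputableMetricSpace.idealPt p.1 : X)) :=
      Measure.smul_finite _ (ENNReal.natCast_ne_top _)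
    infer_instance

variable [BorelSpace X]

theorem integrable_hat (μ : Measure X) [IsFiniteMeasure μ] (s : X) (r : ℝ) :
    Integrable (hat s r) μ := by
  have := secondCountable_of_computable (X := X)
  refine Integrable.of_bound (C := |r|)
    (lipschitz_hat s r).continuous.aestronglyMeasurable (Filter.Eventually.of_forall fun x => ?_)
  rw [Real.norm_of_nonneg (hat_nonneg _ _ _)]
  exact max_le (abs_nonneg _) (by linarith [le_abs_self r, dist_nonneg (x := x) (y := s)])

/-- The hat is positive exactly on the ball and is 1-Lipschitz, so positivity of the measure becomes
positivity of an integral that `W₁` controls. -/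
theorem measure_ball_pos_iff (μ : Measure X) [IsFiniteMeasure μ] (s : X) (r : ℝ) :
    0 < μ (Metric.ball s r) ↔ 0 < ∫ x, hat s r x ∂μ := by
  rw [integral_pos_iff_support_of_nonneg (fun x => hat_nonneg s r x) (integrable_hat μ s r)]
  have : Function.support (hat s r) = Metric.ball s r := by
    ext x
    rw [Function.mem_support, ← hat_pos_iff]
    exact ⟨fun h => lt_of_le_of_ne (hat_nonneg _ _ _) h.symm, fun h => h.ne'⟩
  rw [this]

theorem integral_sum_dirac (l : List (ℕ × ℕ)) (s : X) (r : ℝ) :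
    ∫ x, hat s r x ∂(l.map fun p => ((p.2 + 1 : ℕ) : ℝ≥0∞) •
      Measure.dirac (ComputableMetricSpace.idealPt p.1 : X)).sum =
    (l.map fun p => ((p.2 + 1 : ℕ) : ℝ) * hat s r (ComputableMetricSpace.idealPt p.1)).sum := by
  induction l with
  | nil => simp
  | cons p l ih =>
    have h1 : IsFiniteMeasure (((p.2 + 1 : ℕ) : ℝ≥0∞) •
        Measure.dirac (ComputableMetricSpace.idealPt p.1 : X)) :=
      Measure.smul_finite _ (ENNReal.natCast_ne_top _)
    have h2 := isFiniteMeasure_sum_dirac (X := X) l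
    simp only [List.map_cons, List.sum_cons]
    rw [integral_add_measure (integrable_hat _ _ _) (integrable_hat _ _ _), ih,
      integral_smul_measure, integral_dirac, ENNReal.toReal_natCast, smul_eq_mul]

theorem integral_hat_idealMeasure (c : (ℕ × ℕ) × List (ℕ × ℕ)) (s : X) (r : ℝ) :
    ∫ x, hat s r x ∂(idealMeasure X c) = (totalWeight (c.1 :: c.2) : ℝ)⁻¹ *
      ∑ i ∈ Finset.range (c.1 :: c.2).length, (((((c.1 :: c.2).getD i (0, 0)).2 + 1 : ℕ) : ℝ) *
        hat s r (ComputableMetricSpace.idealPt ((c.1 :: c.2).getD i (0, 0)).1)) := by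
  rw [idealMeasure, integral_smul_measure, integral_sum_dirac, list_sum_eq_range,
    ENNReal.toReal_inv, ENNReal.toReal_natCast, smul_eq_mul]

/-- At precision `k` the integral of the hat is known up to `2 * 2^(-k)`: one `2^(-k)` comes from
`W₁`, one from the rational approximations of the distances. It is positive iff for some `k` the
approximation exceeds `3 * 2^(-k)`. All inequalities are multiplied by the total weight to avoid
division. -/
theorem rePred_measure_pos [BoundedSpace X] (μ : Measure X) [IsFiniteMeasure μ]
    (hμ : IsComputableMeasure μ) : REPred fun n => 0 < μ (idealBall X n) := by
  obtain ⟨φ, hφ, hW⟩ := hμ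
  obtain ⟨D, hD, hDd⟩ := exists_dist_approx (X := X)
  let L : ℕ → List (ℕ × ℕ) := fun k => (φ k).1 :: (φ k).2
  have hL : Computable L :=
    Computable₂.comp Computable.list_cons (Computable.fst.comp hφ) (Computable.snd.comp hφ)
  let e : ℕ × ℕ → ℕ × ℕ := fun p => (L p.1).getD p.2 (0, 0)
  have he : Computable e :=
    Computable₂.comp (f := fun (l : List (ℕ × ℕ)) (n : ℕ) => l.getD n (0, 0))
      (Primrec.list_getD (0, 0)).to_comp (hL.comp Computable.fst) Computable.snd
  let N : ℕ → ℕ := fun k => (L k).length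
  have hN : Computable N := Computable.list_length.comp hL
  let w : ℕ × ℕ → ℚ := fun p => (((e p).2 + 1 : ℕ) : ℚ)
  have hw : CompQ w := CompQ.nat (Computable.succ.comp (Computable.snd.comp he))
  -- the approximate values at the atoms
  let H : (ℕ × ℕ) × ℕ → ℚ := fun x =>
    max 0 (ballRadius x.1.1 - D (((e (x.1.2, x.2)).1, x.1.1.unpair.1), x.1.2))
  have hk : Computable fun x : (ℕ × ℕ) × ℕ => (x.1.2, x.2) :=
    (Computable.snd.comp Computable.fst).pair Computable.snd
  have hc : Computable fun x : (ℕ × ℕ) × ℕ => x.1.1.unpair.1 :=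
    Computable.fst.comp (Computable.unpair.comp (Computable.fst.comp Computable.fst))
  have hH : CompQ H := (CompQ.const 0).max
    ((compQ_ballRadius.comp (Computable.fst.comp Computable.fst)).sub
      (hD.comp (((Computable.fst.comp (he.comp hk)).pair hc).pair
        (Computable.snd.comp Computable.fst))))
  have hS : CompQ fun x : ℕ × ℕ =>
      ∑ i ∈ Finset.range (N x.2), (fun z : (ℕ × ℕ) × ℕ => w (z.1.2, z.2) * H z) (x, i) :=
    CompQ.sum_range ((hw.comp hk).mul hH) (hN.comp Computable.snd)
  have hT : CompQ fun x : ℕ × ℕ => ∑ i ∈ Finset.range (N x.2),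
      (fun z : (ℕ × ℕ) × ℕ => w (z.1.2, z.2)) (x, i) :=
    CompQ.sum_range (hw.comp hk) (hN.comp Computable.snd)
  have hre : REPred fun x : ℕ × ℕ =>
      3 * (1 / 2 : ℚ) ^ x.2 * ∑ i ∈ Finset.range (N x.2), w (x.2, i) <
        ∑ i ∈ Finset.range (N x.2), w (x.2, i) * H (x, i) :=
    ((((CompQ.const 3).mul (CompQ.half_pow Computable.snd)).mul hT).lt hS).to_re
  refine (REPred.exists_nat hre).of_eq fun n => ?_
  have hball : idealBall X n = Metric.ball (ballCenter X n) (ballRadius n) := rfl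
  rw [hball, measure_ball_pos_iff]
  set I := ∫ x, hat (ballCenter X n) (ballRadius n) x ∂μ
  have hest : ∀ k : ℕ, |(∑ i ∈ Finset.range (N k), (w (k, i) : ℝ) * H ((n, k), i)) -
      I * ∑ i ∈ Finset.range (N k), (w (k, i) : ℝ)| ≤
        2 * (1 / 2 : ℝ) ^ k * ∑ i ∈ Finset.range (N k), (w (k, i) : ℝ) := by
    intro k
    have h1 := abs_integral_sub_lt (lipschitz_hat (ballCenter X n) (ballRadius n)) (hW k)
    rw [integral_hat_idealMeasure, totalWeight_eq] at h1
    have hWw : ((∑ i ∈ Finset.range (L k).length, (((L k).getD i (0, 0)).2 + 1) : ℕ) : ℝ) =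
        ∑ i ∈ Finset.range (N k), (w (k, i) : ℝ) := by
      push_cast [w, e, N]
      rfl
    have hpos : (0 : ℝ) < ∑ i ∈ Finset.range (N k), (w (k, i) : ℝ) := by
      rw [← hWw, ← totalWeight_eq]
      exact_mod_cast totalWeight_pos _ _
    have h2 : |(∑ i ∈ Finset.range (N k), (w (k, i) : ℝ) *
        hat (ballCenter X n) (ballRadius n) (ComputableMetricSpace.idealPt (e (k, i)).1)) -
          I * ∑ i ∈ Finset.range (N k), (w (k, i) : ℝ)| ≤
        (1 / 2 : ℝ) ^ k * ∑ i ∈ Finset.range (N k), (w (k, i) : ℝ) := by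
      change |((∑ i ∈ Finset.range (L k).length, (((L k).getD i (0, 0)).2 + 1) : ℕ) : ℝ)⁻¹ * _ - I|
        < _ at h1
      rw [hWw] at h1
      have h3 := mul_le_mul_of_nonneg_right h1.le hpos.le
      rw [← abs_of_pos hpos, ← abs_mul, abs_of_pos hpos, sub_mul, mul_comm _⁻¹, mul_assoc,
        inv_mul_cancel₀ hpos.ne', mul_one] at h3
      simpa [w, e, N, L] using h3
    have h3 : |(∑ i ∈ Finset.range (N k), (w (k, i) : ℝ) * H ((n, k), i)) -
        ∑ i ∈ Finset.range (N k), (w (k, i) : ℝ) *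
          hat (ballCenter X n) (ballRadius n) (ComputableMetricSpace.idealPt (e (k, i)).1)| ≤
        (1 / 2 : ℝ) ^ k * ∑ i ∈ Finset.range (N k), (w (k, i) : ℝ) := by
      rw [← Finset.sum_sub_distrib, Finset.mul_sum]
      refine (Finset.abs_sum_le_sum_abs _ _).trans (Finset.sum_le_sum fun i _ => ?_)
      have hw0 : (0 : ℝ) ≤ w (k, i) := by simp only [w]; positivity
      rw [← mul_sub, abs_mul, abs_of_nonneg hw0, mul_comm]
      refine mul_le_mul_of_nonneg_right ?_ hw0
      have h4 := hDd (e (k, i)).1 n.unpair.1 k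
      simp only [H, hat]
      push_cast
      rw [max_comm 0, max_comm 0]
      refine (abs_max_sub_max_le_abs _ _ _).trans ?_
      rw [sub_sub_sub_cancel_left]
      exact h4.le
    have := abs_sub_le (∑ i ∈ Finset.range (N k), (w (k, i) : ℝ) * H ((n, k), i))
      (∑ i ∈ Finset.range (N k), (w (k, i) : ℝ) *
          hat (ballCenter X n) (ballRadius n) (ComputableMetricSpace.idealPt (e (k, i)).1))
      (I * ∑ i ∈ Finset.range (N k), (w (k, i) : ℝ))
    linarith
  have hpos : ∀ k, (0 : ℝ) < ∑ i ∈ Finset.range (N k), (w (k, i) : ℝ) := fun k =>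
    Finset.sum_pos (fun i _ => by simp only [w]; positivity)
      (Finset.nonempty_range_iff.2 (by simp [N, L]))
  constructor
  · rintro ⟨k, hk⟩
    dsimp only at hk
    have hk' : 3 * (1 / 2 : ℝ) ^ k * ∑ i ∈ Finset.range (N k), (w (k, i) : ℝ) <
        ∑ i ∈ Finset.range (N k), (w (k, i) : ℝ) * H ((n, k), i) := by
      have h := (Rat.cast_lt (K := ℝ)).2 hk
      push_cast at h
      exact h
    have h1 := (abs_le.1 (hest k)).2
    have h2 : 0 < (1 / 2 : ℝ) ^ k * ∑ i ∈ Finset.range (N k), (w (k, i) : ℝ) :=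
      mul_pos (by positivity) (hpos k)
    by_contra hI
    have h3 : I * ∑ i ∈ Finset.range (N k), (w (k, i) : ℝ) ≤ 0 :=
      mul_nonpos_of_nonpos_of_nonneg (not_lt.1 hI) (hpos k).le
    linarith
  · intro hI
    -- `5 = 3 + 2`: the threshold plus the error of the approximation.
    obtain ⟨k, hk⟩ := exists_pow_lt_of_lt_one (show 0 < I / 5 by positivity)
      (show (1 / 2 : ℝ) < 1 by norm_num)
    refine ⟨k, ?_⟩
    dsimp only
    have h1 := (abs_le.1 (hest k)).1
    have h2 := mul_lt_mul_of_pos_right hk (hpos k)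
    have h3 : 3 * (1 / 2 : ℝ) ^ k * ∑ i ∈ Finset.range (N k), (w (k, i) : ℝ) <
        ∑ i ∈ Finset.range (N k), (w (k, i) : ℝ) * H ((n, k), i) := by
      linarith
    rw [← Rat.cast_lt (K := ℝ)]
    push_cast
    exact h3

/-- A ball of positive measure is a countable union of small ideal balls formally inside it, and by
countable subadditivity one of these has positive measure. The search for nested balls can therefore
always continue. -/
theorem exists_computable_mem_support [BoundedSpace X] (μ : Measure X) [IsProbabilityMeasure μ]
    (hμ : IsComputableMeasure μ) : ∃ x ∈ μ.support, IsComputablePoint x := by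
  have hcover : ∀ (S : Set X) (Q : ℕ → Prop), 0 < μ S →
      (∀ x ∈ S, ∃ m, x ∈ idealBall X m ∧ Q m) → ∃ m, 0 < μ (idealBall X m) ∧ Q m := by
    intro S Q hS h
    by_contra! hcon
    refine hS.ne' (measure_mono_null (t := ⋃ m : {m // Q m}, idealBall X m) (fun x hx => ?_)
      (measure_iUnion_null fun m => ?_))
    · obtain ⟨m, hm, hQ⟩ := h x hx
      exact mem_iUnion.2 ⟨⟨m, hQ⟩, hm⟩
    · by_contra h0
      exact hcon m (pos_iff_ne_zero.2 h0) m.2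
  obtain ⟨x, hx, hU⟩ := exists_computable_point_of_rePred (X := X) (rePred_measure_pos μ hμ)
    (by
      obtain ⟨m, hm, -⟩ := hcover univ (fun _ => True) (by simp) fun x _ => by
        obtain ⟨n, hn, -⟩ := exists_mem_idealBall_radius_lt x one_pos
        exact ⟨n, hn, trivial⟩
      exact ⟨m, hm⟩)
    (fun n hn => hcover _ (fun m => FormallyInside X m n ∧ ballRadius m < ballRadius n / 2) hn
      fun x hx => by
        obtain ⟨m, hm, hmn, hr⟩ := exists_formallyInside hx (half_pos (ballRadius_pos' n))
        exact ⟨m, hm, hmn, by exact_mod_cast hr⟩)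
  refine ⟨x, (Measure.mem_support_iff_forall x).2 fun U hxU => ?_, hx⟩
  obtain ⟨n, hn, hsub⟩ := hU U hxU
  exact hn.trans_le (measure_mono hsub)

end ComputableMeasure

/-! ### A recursively compact set without computable points -/

section Seed

theorem ballCenter_real (n : ℕ) : ballCenter ℝ n = (ratOfCode n.unpair.1 : ℝ) := rfl

theorem compQ_center : CompQ fun n : ℕ => ratOfCode n.unpair.1 :=
  compQ_ratOfCode.comp (Computable.fst.comp Computable.unpair)

theorem idealBall_real (n : ℕ) :
    idealBall ℝ n = Ioo ((ratOfCode n.unpair.1 : ℝ) - ballRadius n)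
      ((ratOfCode n.unpair.1 : ℝ) + ballRadius n) :=
  Real.ball_eq_Ioo _ _

theorem ratCast_mem_idealBall_iff (q : ℚ) (n : ℕ) :
    (q : ℝ) ∈ idealBall ℝ n ↔ |q - ratOfCode n.unpair.1| < ballRadius n := by
  rw [mem_idealBall, ballCenter_real, Real.dist_eq]
  norm_cast

theorem computablePred_ratCast_mem_idealBall {α : Type*} [Primcodable α] {F : α → ℚ} {g : α → ℕ}
    (hF : CompQ F) (hg : Computable g) :
    ComputablePred fun a => (F a : ℝ) ∈ idealBall ℝ (g a) :=
  ((hF.sub (compQ_center.comp hg)).abs.lt (compQ_ballRadius.comp hg)).of_eq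
    fun _ => (ratCast_mem_idealBall_iff _ _).symm

/-- If the program with number `e`, started on its own number, returns the number of an ideal ball
of radius at most `2 ^ (-e - 3)`, then this ball is removed. -/
def RemovedBy (e n : ℕ) : Prop :=
  n ∈ Nat.Partrec.Code.eval (Denumerable.ofNat Nat.Partrec.Code e) e ∧
    ballRadius n ≤ (1 / 2) ^ (e + 3)

/-- The complement in `[0, 1]` of the removed ideal balls. -/
def diagonalSet : Set ℝ := Icc 0 1 \ ⋃ n ∈ {n | ∃ e, RemovedBy e n}, idealBall ℝ n

theorem rePred_removed : REPred fun n => ∃ e, RemovedBy e n := by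
  have h1 : REPred fun p : ℕ × ℕ =>
      p.1 ∈ Nat.Partrec.Code.eval (Denumerable.ofNat Nat.Partrec.Code p.2) p.2 := by
    have hp : PrimrecPred fun x : (ℕ × ℕ) × ℕ => Nat.Partrec.Code.evaln x.2
        (Denumerable.ofNat Nat.Partrec.Code x.1.2) x.1.2 = some x.1.1 := by
      have h2 : Primrec fun x : (ℕ × ℕ) × ℕ => x.1.2 := Primrec.snd.comp Primrec.fst
      exact Primrec.eq.comp (Nat.Partrec.Code.primrec_evaln.comp
        ((Primrec.snd.pair ((Primrec.ofNat Nat.Partrec.Code).comp h2)).pair h2))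
        (Primrec.option_some.comp (Primrec.fst.comp Primrec.fst))
    refine (REPred.exists_nat hp.computablePred.to_re).of_eq fun p => ?_
    rw [Nat.Partrec.Code.evaln_complete]
    rfl
  exact REPred.exists_nat (p := fun p : ℕ × ℕ => RemovedBy p.2 p.1)
    (h1.and ((compQ_ballRadius.comp Computable.fst).le
      (CompQ.half_pow (Computable.natAdd Computable.snd (Computable.const 3)))).to_re)

theorem isCompact_diagonalSet : IsCompact diagonalSet :=
  isCompact_Icc.diff (isOpen_biUnion fun n _ => isOpen_idealBall n)

theorem diagonalSet_nonempty : diagonalSet.Nonempty := by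
  by_contra hne
  rw [not_nonempty_iff_eq_empty, diagonalSet, sdiff_eq_empty] at hne
  have hsub : Icc (0 : ℝ) 1 ⊆ ⋃ e, {x | ∃ n, RemovedBy e n ∧ x ∈ idealBall ℝ n} := by
    intro x hx
    obtain ⟨n, ⟨e, he⟩, hxn⟩ := mem_iUnion₂.1 (hne hx)
    exact mem_iUnion.2 ⟨e, n, he, hxn⟩
  -- A program returns at most one value, so stage `e` removes at most one ball, of length at most
  -- `2 * 2^(-e-3)`. The sum over `e` is `1/2`.
  have hvol : ∀ e : ℕ, volume {x : ℝ | ∃ n, RemovedBy e n ∧ x ∈ idealBall ℝ n} ≤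
      ENNReal.ofReal ((1 / 4) * (1 / 2 : ℝ) ^ e) := by
    intro e
    by_cases h : ∃ n, RemovedBy e n
    · obtain ⟨n, hn⟩ := h
      have h1 : {x : ℝ | ∃ n, RemovedBy e n ∧ x ∈ idealBall ℝ n} ⊆ idealBall ℝ n := by
        rintro x ⟨m, hm, hx⟩
        rwa [Part.mem_unique hn.1 hm.1]
      refine (measure_mono h1).trans ?_
      rw [show idealBall ℝ n = Metric.ball (ballCenter ℝ n) (ballRadius n) from rfl,
        Real.volume_ball]
      refine ENNReal.ofReal_le_ofReal ?_
      have h2 : (ballRadius n : ℝ) ≤ (1 / 2) ^ (e + 3) := by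
        have := (Rat.cast_le (K := ℝ)).2 hn.2
        push_cast at this
        exact this
      rw [pow_add] at h2
      linarith
    · have : {x : ℝ | ∃ n, RemovedBy e n ∧ x ∈ idealBall ℝ n} = ∅ := by
        ext x
        simp only [mem_ofPred_eq, mem_empty_iff_false, iff_false]
        rintro ⟨n, hn, -⟩
        exact h ⟨n, hn⟩
      simp [this]
  have hle := (measure_mono hsub).trans ((measure_iUnion_le _).trans (ENNReal.tsum_le_tsum hvol))
  rw [← ENNReal.ofReal_tsum_of_nonneg (fun n => by positivity)
    (summable_geometric_two.mul_left _), tsum_mul_left, tsum_geometric_two, Real.volume_Icc] at hle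
  have := (ENNReal.ofReal_le_ofReal_iff (by norm_num)).1 hle
  norm_num at this

/-- If `x` were computable, a total program would find for each `k` a ball around `x` of radius at
most `2^(-k-3)`. Run on its own number, it has its output removed, and `x` with it. -/
theorem diagonalSet_no_computable : ∀ x ∈ diagonalSet, ¬ IsComputablePoint x := by
  rintro x ⟨-, hx⟩ hc
  have hre : REPred fun p : ℕ × ℕ => x ∈ idealBall ℝ p.2 ∧ ballRadius p.2 ≤ (1 / 2) ^ (p.1 + 3) :=
    (REPred.comp hc Computable.snd).and ((compQ_ballRadius.comp Computable.snd).le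
      (CompQ.half_pow (Computable.natAdd Computable.fst (Computable.const 3)))).to_re
  obtain ⟨g, hg, h⟩ := REPred.exists_computable hre fun k => by
    obtain ⟨n, hn, hr⟩ := exists_mem_idealBall_radius_lt x
      (show (0 : ℝ) < (1 / 2) ^ (k + 3) by positivity)
    refine ⟨n, hn, ?_⟩
    rw [← Rat.cast_le (K := ℝ)]
    push_cast
    exact hr.le
  obtain ⟨c, hcg⟩ := Nat.Partrec.Code.exists_code.1 (Partrec.nat_iff.1 hg)
  have hev : g (Encodable.encode c) ∈ Nat.Partrec.Code.eval
      (Denumerable.ofNat Nat.Partrec.Code (Encodable.encode c)) (Encodable.encode c) := by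
    rw [Denumerable.ofNat_encode, hcg]
    exact Part.mem_some _
  obtain ⟨h1, h2⟩ := h (Encodable.encode c)
  exact hx (mem_iUnion₂.2 ⟨_, ⟨_, hev, h2⟩, h1⟩)

/-- A set of the form `[0, 1] \ U` with `U` recursively open is recursively compact. -/
theorem rePred_Icc_diff_subset {E : ℕ → Prop} (hE : REPred E) :
    REPred fun l : List ℕ =>
      Icc (0 : ℝ) 1 \ ⋃ n ∈ {n | E n}, idealBall ℝ n ⊆ ⋃ i ∈ {i | i ∈ l}, idealBall ℝ i := by
  have hmem : REPred fun x : ((List ℕ × ℕ) × ℕ) × ℕ => x.2 ∈ x.1.1.1 := by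
    have h : PrimrecRel fun (L : List ℕ) (b : ℕ) => ∃ a ∈ L, a = b :=
      PrimrecRel.exists_mem_list Primrec.eq
    exact (h.comp (Primrec.fst.comp (Primrec.fst.comp Primrec.fst))
      Primrec.snd).computablePred.to_re.of_eq fun x => by simp
  -- The mesh `1 / (M + 1)` of the grid, in the shape given by `CompQ.of_frac`.
  have hM : CompQ fun x : ((List ℕ × ℕ) × ℕ) × ℕ => ((0 + 1 : ℕ) - (0 : ℕ) : ℚ) / (x.1.1.2 + 1) :=
    CompQ.of_frac (Computable.const 1) (Computable.const 0)
      (Computable.snd.comp (Computable.fst.comp Computable.fst))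
  have hk : Computable fun x : ((List ℕ × ℕ) × ℕ) × ℕ => x.1.2 :=
    Computable.snd.comp Computable.fst
  have hin : ∀ d : ℕ, REPred fun x : ((List ℕ × ℕ) × ℕ) × ℕ =>
      (((x.1.2 + d : ℕ) * (((0 + 1 : ℕ) - (0 : ℕ)) / (x.1.1.2 + 1)) : ℚ) : ℝ) ∈
        idealBall ℝ x.2 := fun d =>
    (computablePred_ratCast_mem_idealBall
      ((CompQ.nat (Computable.natAdd hk (Computable.const d))).mul hM) Computable.snd).to_re
  -- Some grid has, for each of its `M + 1` cells, a ball from the list or from `E` containing both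
  -- endpoints; balls of the line are convex, so it contains the cell.
  have hre := REPred.exists_nat (REPred.forall_lt (REPred.exists_nat
    ((hmem.or (REPred.comp hE Computable.snd)).and ((hin 0).and (hin 1))))
    (Computable.succ.comp (Computable.snd (α := List ℕ) (β := ℕ))))
  refine hre.of_eq fun l => ?_
  dsimp only
  push_cast
  simp only [add_zero, sub_zero, mul_one_div]
  constructor
  · rintro ⟨M, hMl⟩ x ⟨hx, hxE⟩
    have hM0 : (0 : ℝ) < (M : ℝ) + 1 := by positivity
    obtain ⟨k, hkM, hkx, hxk⟩ : ∃ k < M + 1, (k : ℝ) / (M + 1) ≤ x ∧ x ≤ ((k : ℝ) + 1) / (M + 1) := by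
      rcases hx.2.lt_or_eq with h1 | h1
      · have hnn : 0 ≤ x * (M + 1) := mul_nonneg hx.1 hM0.le
        refine ⟨⌊x * (M + 1)⌋₊, ?_, ?_, ?_⟩
        · rw [Nat.floor_lt hnn]
          push_cast
          nlinarith
        · rw [div_le_iff₀ hM0]
          exact Nat.floor_le hnn
        · rw [le_div_iff₀ hM0]
          exact (Nat.lt_floor_add_one _).le
      -- The point `1` has floor `M + 1` after scaling, so it is assigned to the last cell by hand.
      · refine ⟨M, Nat.lt_succ_self M, ?_, ?_⟩
        · rw [h1, div_le_one hM0]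
          linarith
        · rw [h1, div_self hM0.ne']
    obtain ⟨m, hm, hm1, hm2⟩ := hMl k hkM
    have hxm : x ∈ idealBall ℝ m := by
      rw [idealBall_real] at *
      exact ⟨hm1.1.trans_le hkx, hxk.trans_lt hm2.2⟩
    rcases hm with hm | hm
    · exact mem_iUnion₂.2 ⟨m, hm, hxm⟩
    · exact absurd (mem_iUnion₂.2 ⟨m, hm, hxm⟩) hxE
  · intro hsub
    have hcov : Icc (0 : ℝ) 1 ⊆ ⋃ m : {m // m ∈ l ∨ E m}, idealBall ℝ m := by
      intro x hx
      by_cases hxE : x ∈ ⋃ n ∈ {n | E n}, idealBall ℝ n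
      · obtain ⟨n, hn, hxn⟩ := mem_iUnion₂.1 hxE
        exact mem_iUnion.2 ⟨⟨n, Or.inr hn⟩, hxn⟩
      · obtain ⟨n, hn, hxn⟩ := mem_iUnion₂.1 (hsub ⟨hx, hxE⟩)
        exact mem_iUnion.2 ⟨⟨n, Or.inl hn⟩, hxn⟩
    -- A mesh below the Lebesgue number of the cover forces each cell into a single ball.
    obtain ⟨δ, hδ, hδc⟩ := lebesgue_number_lemma_of_metric isCompact_Icc
      (fun m => isOpen_idealBall _) hcov
    obtain ⟨M, hM⟩ := exists_nat_one_div_lt hδ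
    refine ⟨M, fun k hkM => ?_⟩
    have hM0 : (0 : ℝ) < (M : ℝ) + 1 := by positivity
    have hkM' : (k : ℝ) < M + 1 := by exact_mod_cast hkM
    obtain ⟨⟨m, hm⟩, hball⟩ := hδc ((k : ℝ) / (M + 1))
      ⟨by positivity, (div_le_one hM0).2 hkM'.le⟩
    refine ⟨m, hm, hball (Metric.mem_ball_self hδ), hball ?_⟩
    rw [Metric.mem_ball, Real.dist_eq, add_div, add_sub_cancel_left,
      abs_of_pos (by positivity)]
    exact hM

theorem isSeedSet_diagonalSet : IsSeedSet diagonalSet where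
  subset := sdiff_subset
  nonempty := diagonalSet_nonempty
  recCompact := ⟨isCompact_diagonalSet, rePred_Icc_diff_subset rePred_removed⟩
  no_computable := diagonalSet_no_computable

end Seed

/-! ### The standard data of the construction -/

section StandardData

variable {α : Type*} [Primcodable α]

theorem CompQ.exists_posCode {F : α → ℚ} (hF : CompQ F) :
    ∃ g : α → ℕ, Computable g ∧ ∀ a, 0 < F a → posRatOfCode (g a) = F a := by
  obtain ⟨A, B, C, hA, hB, hC, h⟩ := hF.exists_frac
  have hs : Computable fun a => A a - B a := Computable₂.comp Primrec.nat_sub.to_comp hA hB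
  refine ⟨fun a => Nat.pair (A a - B a - 1) (C a), Computable.natPair
    (Computable.pred.comp hs) hC, fun a ha => ?_⟩
  rw [h, div_pos_iff_of_pos_right (by positivity), sub_pos, Nat.cast_lt] at ha
  rw [h]
  simp only [posRatOfCode, Nat.unpair_pair]
  congr 1
  have : A a = (A a - B a - 1) + 1 + B a := by omega
  rw [eq_sub_iff_add_eq]
  exact_mod_cast this.symm

/-- The centre is the midpoint and the radius half the length. -/
theorem exists_ballCode {F G : α → ℚ} (hF : CompQ F) (hG : CompQ G) :
    ∃ g : α → ℕ, Computable g ∧ ∀ a, F a < G a → idealBall ℝ (g a) = Ioo (F a : ℝ) (G a) := by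
  obtain ⟨c, hc, h⟩ := (hF.add hG).mul (CompQ.const (1 / 2))
  obtain ⟨r, hr, h'⟩ := ((hG.sub hF).mul (CompQ.const (1 / 2))).exists_posCode
  refine ⟨_, Computable.natPair hc hr, fun a ha => ?_⟩
  rw [idealBall_real, ballRadius]
  simp only [Nat.unpair_pair]
  have h1 : 0 < (G a - F a) * (1 / 2) := by linarith
  rw [h' a h1, ← h a]
  push_cast
  congr 1 <;> ring

theorem isComputablePoint_idealPt {X : Type*} [MetricSpace X] [ComputableMetricSpace X] (i : ℕ) :
    IsComputablePoint (ComputableMetricSpace.idealPt i : X) := by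
  have h := REPred.lt_compQ
    (F := fun n : ℕ => dist (ComputableMetricSpace.idealPt i : X) (ballCenter X n))
    (REPred.comp (ComputableMetricSpace.dist_upper (X := X))
      (((Computable.const i).pair (Computable.fst.comp
        (Computable.unpair.comp Computable.fst))).pair Computable.snd))
    compQ_ballRadius
  exact h.of_eq fun n => Iff.rfl

theorem isComputablePoint_ratCast (q : ℚ) : IsComputablePoint (q : ℝ) := by
  obtain ⟨i, rfl⟩ := ratOfCode_surjective q
  exact isComputablePoint_idealPt (X := ℝ) i

theorem isComputableSeq_ratCast {F : ℕ → ℚ} (hF : CompQ F) :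
    IsComputableSeq fun n => (F n : ℝ) :=
  (computablePred_ratCast_mem_idealBall (hF.comp Computable.fst) Computable.snd).to_re

/-- Uniformly Lipschitz functions with uniformly computable rational values at the rationals are
uniformly computable. -/
theorem uniformlyComputableOn_of_lipschitz {f : ℕ → ℝ → ℝ} (hf : ∀ i, LipschitzWith 2 (f i))
    {F : ℕ × ℕ → ℚ} (hF : CompQ F) (h : ∀ i n, f i (ratOfCode n) = F (i, n)) (C : Set ℝ) :
    UniformlyComputableOn f C := by
  -- A ball is admitted if the image of its centre, enlarged by the Lipschitz constant `2` times its
  -- radius, fits in the target ball.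
  let E : ℕ × ℕ → Prop := fun p =>
    |F (p.1.unpair.1, p.2.unpair.1) - ratOfCode p.1.unpair.2.unpair.1| + 2 * ballRadius p.2 <
      ballRadius p.1.unpair.2
  have hu : Computable fun p : ℕ × ℕ => p.1.unpair := Computable.unpair.comp Computable.fst
  have hE : REPred E := by
    refine (CompQ.lt (CompQ.add (CompQ.abs (CompQ.sub (hF.comp ((Computable.fst.comp hu).pair
      (Computable.fst.comp (Computable.unpair.comp Computable.snd))))
      (compQ_center.comp (Computable.snd.comp hu)))) ((CompQ.const 2).mul
        (compQ_ballRadius.comp Computable.snd)))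
      (compQ_ballRadius.comp (Computable.snd.comp hu))).to_re
  refine ⟨fun p => ⋃ m ∈ {m | E (p, m)}, idealBall ℝ m, ⟨E, hE, fun _ => rfl⟩, fun i n => ?_⟩
  congr 1
  have hE' : ∀ m, E (Nat.pair i n, m) ↔ dist (f i (ballCenter ℝ m)) (ballCenter ℝ n) +
      2 * ballRadius m < ballRadius n := by
    intro m
    simp only [E, Nat.unpair_pair, ballCenter_real]
    rw [h, Real.dist_eq, ← Rat.cast_lt (K := ℝ)]
    push_cast
    rfl
  have hlip : ∀ x y, dist (f i x) (f i y) ≤ 2 * dist x y := fun x y => (hf i).dist_le_mul x y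
  ext x
  simp only [mem_preimage, mem_iUnion₂, mem_ofPred_eq, hE']
  constructor
  · intro hx
    rw [mem_idealBall] at hx
    -- A quarter of the slack: two radii are lost in moving from `f i x` to the image of the centre,
    -- two more in the condition `E`.
    obtain ⟨m, hm, hr⟩ := exists_mem_idealBall_radius_lt x (half_pos (half_pos (sub_pos.2 hx)))
    refine ⟨m, ?_, hm⟩
    rw [mem_idealBall] at hm
    have h1 := hlip x (ballCenter ℝ m)
    linarith [dist_triangle_left (f i (ballCenter ℝ m)) (ballCenter ℝ n) (f i x)]
  · rintro ⟨m, hE, hm⟩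
    rw [mem_idealBall] at *
    have h1 := hlip x (ballCenter ℝ m)
    linarith [dist_triangle (f i x) (f i (ballCenter ℝ m)) (ballCenter ℝ n)]

/-- From this form the Lipschitz bound, monotonicity and rational computability can be read off. -/
theorem standardStep_eq (a b : ℕ → ℝ) (i : ℕ) (x : ℝ) :
    standardStep a b i x = max x (min (2 * x - a i) (b i)) := by
  unfold standardStep
  split_ifs with h1 h2
  · rw [min_eq_left (by linarith), max_eq_right (by linarith)]
  · rw [min_eq_right (by linarith), max_eq_right (by linarith)]
  · rw [max_eq_left]
    rcases lt_or_ge x (a i) with hx | hx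
    · exact (min_le_left _ _).trans (by linarith)
    · have h3 : (a i + b i) / 2 < x := by
        by_contra h4
        exact h1 ⟨hx, not_lt.1 h4⟩
      have h5 : b i < x := by
        by_contra h4
        exact h2 ⟨h3.le, not_lt.1 h4⟩
      exact (min_le_right _ _).trans h5.le

theorem lipschitz_standardStep (a b : ℕ → ℝ) (i : ℕ) :
    LipschitzWith 2 (standardStep a b i) := by
  refine LipschitzWith.of_le_add_mul _ fun x y => ?_
  rw [standardStep_eq, standardStep_eq]
  have h1 := le_abs_self (x - y)
  have h0 := abs_nonneg (x - y)
  rw [Real.dist_eq]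
  push_cast
  refine max_le (by linarith [le_max_left y (min (2 * y - a i) (b i))]) ?_
  have h2 := le_max_right y (min (2 * y - a i) (b i))
  refine le_trans ?_ (add_le_add_left h2 _)
  rcases min_cases (2 * y - a i) (b i) with ⟨e, -⟩ | ⟨e, -⟩ <;> rw [e]
  · exact (min_le_left _ _).trans (by linarith)
  · exact (min_le_right _ _).trans (by linarith)

/-- `K` misses `[p, q] ⊆ (0,1)` iff the balls `(-1, p)` and `(q, 2)` cover it, which recursive
compactness semi-decides. The intervals `(p, q)` so enumerated fill the open set `(0,1) \ K`. -/
theorem IsSeedSet.exists_isConstruction {K : Set ℝ} (hK : IsSeedSet K) :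
    ∃ (a b : ℕ → ℝ) (ε : ℚ), IsConstruction K a b ε (standardStep a b) := by
  have hrat : ∀ q : ℚ, (q : ℝ) ∉ K := fun q hq =>
    hK.no_computable _ hq (isComputablePoint_ratCast q)
  have hcpt := hK.recCompact.1
  -- the rational intervals whose closure misses `K`
  let A : ℕ → ℚ := fun n => ratOfCode n.unpair.1
  let B : ℕ → ℚ := fun n => ratOfCode n.unpair.2
  have hA : CompQ A := compQ_center
  have hB : CompQ B := compQ_ratOfCode.comp (Computable.snd.comp Computable.unpair)
  obtain ⟨g₁, hg₁, h₁⟩ := exists_ballCode (CompQ.const (-1)) hA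
  obtain ⟨g₂, hg₂, h₂⟩ := exists_ballCode hB (CompQ.const 2)
  let P : ℕ → Prop := fun n => ((0 < A n ∧ A n < B n) ∧ B n < 1) ∧
    K ⊆ ⋃ i ∈ {i | i ∈ [g₁ n, g₂ n]}, idealBall ℝ i
  have hP : REPred P := by
    refine REPred.and (((((CompQ.const 0).lt hA).to_re).and (hA.lt hB).to_re).and
      (hB.lt (CompQ.const 1)).to_re) (REPred.comp hK.recCompact.2
        (Computable₂.comp Computable.list_cons hg₁
          (Computable₂.comp Computable.list_cons hg₂ (Computable.const []))))
  have hP' : ∀ n, P n ↔ ((0 < A n ∧ A n < B n) ∧ B n < 1) ∧ Icc (A n : ℝ) (B n) ∩ K = ∅ := by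
    intro n
    refine and_congr_right fun ⟨⟨h0, hAB⟩, hB1⟩ => ?_
    have hu : (⋃ i ∈ {i | i ∈ [g₁ n, g₂ n]}, idealBall ℝ i) =
        Ioo (-1 : ℝ) (A n) ∪ Ioo (B n : ℝ) 2 := by
      have e₁ := h₁ n (by linarith)
      have e₂ := h₂ n (by linarith)
      push_cast at e₁ e₂
      rw [← e₁, ← e₂]
      ext x
      simp
    have hB1' : (B n : ℝ) < 1 := by exact_mod_cast hB1
    have h0' : (0 : ℝ) < A n := by exact_mod_cast h0
    rw [hu, ← disjoint_iff_inter_eq_empty, Set.disjoint_right]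
    refine forall₂_congr fun x hx => ?_
    have := hK.subset hx
    simp only [mem_union, mem_Ioo, mem_Icc, not_and_or, not_le]
    constructor
    · rintro (h | h)
      · exact Or.inl h.2
      · exact Or.inr h.1
    · rintro (h | h)
      · exact Or.inl ⟨by linarith [this.1], h⟩
      · exact Or.inr ⟨h, by linarith [this.2]⟩
  have hex : ∀ x ∈ Ioo (0 : ℝ) 1 \ K, ∃ n, P n ∧ x ∈ Ioo (A n : ℝ) (B n) := by
    intro x hx
    obtain ⟨l, u, hlu, hsub⟩ := mem_nhds_iff_exists_Ioo_subset.1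
      ((isOpen_Ioo.sdiff hcpt.isClosed).mem_nhds hx)
    obtain ⟨a, hla, hax⟩ := exists_rat_btwn hlu.1
    obtain ⟨b, hxb, hbu⟩ := exists_rat_btwn hlu.2
    obtain ⟨i, rfl⟩ := ratOfCode_surjective a
    obtain ⟨j, rfl⟩ := ratOfCode_surjective b
    have hs : ∀ y ∈ Icc (ratOfCode i : ℝ) (ratOfCode j), y ∈ Ioo (0 : ℝ) 1 \ K := fun y hy =>
      hsub ⟨hla.trans_le hy.1, hy.2.trans_lt hbu⟩
    have hij := (hax.trans hxb).le
    refine ⟨Nat.pair i j, (hP' _).2 ⟨⟨⟨?_, ?_⟩, ?_⟩, ?_⟩, ?_⟩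
    all_goals simp only [A, B, Nat.unpair_pair]
    · exact_mod_cast (hs _ (left_mem_Icc.2 hij)).1.1
    · exact_mod_cast hax.trans hxb
    · exact_mod_cast (hs _ (right_mem_Icc.2 hij)).1.2
    · rw [← disjoint_iff_inter_eq_empty, Set.disjoint_left]
      exact fun y hy => (hs y hy).2
    · exact ⟨hax, hxb⟩
  -- Rationals are computable and so avoid `K`; the point `1/2` shows that there is an interval to
  -- enumerate.
  have hhalf : (1 / 2 : ℝ) ∈ Ioo (0 : ℝ) 1 \ K := by
    refine ⟨by norm_num, ?_⟩
    have := hrat (1 / 2)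
    push_cast at this
    exact this
  obtain ⟨f, hf, hfP⟩ := hP.exists_enumeration ((hex _ hhalf).imp fun n h => h.1)
  have hfP' : ∀ i, ((0 < A (f i) ∧ A (f i) < B (f i)) ∧ B (f i) < 1) ∧
      Icc (A (f i) : ℝ) (B (f i)) ∩ K = ∅ := fun i => (hP' _).1 ((hfP _).2 ⟨i, rfl⟩)
  obtain ⟨m, hm⟩ := hcpt.exists_isLeast hK.nonempty
  obtain ⟨M, hM⟩ := hcpt.exists_isGreatest hK.nonempty
  have hm0 : 0 < m := (hK.subset hm.1).1.lt_of_ne fun h => by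
    have := hrat 0
    push_cast at this
    exact this (h ▸ hm.1)
  have hM1 : M < 1 := (hK.subset hM.1).2.lt_of_ne fun h => by
    have := hrat 1
    push_cast at this
    exact this (h ▸ hM.1)
  -- The points `0` and `1` are not in `K` either, so the compact set `K` stays away from both ends.
  obtain ⟨ε, hε0, hε⟩ := exists_rat_btwn (lt_min hm0 (sub_pos.2 hM1))
  have hpos : ∀ i, (0 : ℝ) < A (f i) := fun i => by exact_mod_cast (hfP' i).1.1.1
  have hlt : ∀ i, (A (f i) : ℝ) < B (f i) := fun i => by exact_mod_cast (hfP' i).1.1.2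
  have hone : ∀ i, (B (f i) : ℝ) < 1 := fun i => by exact_mod_cast (hfP' i).1.2
  refine ⟨fun i => A (f i), fun i => B (f i), ε, ?_⟩
  have hstep : ∀ i x, standardStep (fun i => (A (f i) : ℝ)) (fun i => B (f i)) i x =
    max x (min (2 * x - A (f i)) (B (f i))) := fun i => standardStep_eq _ _ i
  exact {
    computable_a := isComputableSeq_ratCast (hA.comp hf)
    computable_b := isComputableSeq_ratCast (hB.comp hf)
    a_pos := hpos
    a_lt_b := hlt
    b_lt_one := hone
    cover := by
      ext x
      constructor
      · intro hx
        obtain ⟨n, hn, hxn⟩ := hex x hx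
        obtain ⟨i, rfl⟩ := (hfP _).1 hn
        exact mem_iUnion.2 ⟨i, hxn⟩
      · intro hx
        obtain ⟨i, hi⟩ := mem_iUnion.1 hx
        refine ⟨⟨(hpos i).trans hi.1, hi.2.trans (hone i)⟩, fun hxK => ?_⟩
        have := (hfP' i).2
        rw [← disjoint_iff_inter_eq_empty, Set.disjoint_left] at this
        exact this ⟨hi.1.le, hi.2.le⟩ hxK
    ε_pos := by exact_mod_cast hε0
    margin := fun x hx => ⟨hε.le.trans ((min_le_left _ _).trans (hm.2 hx)), by
      linarith [hM.2 hx, hε.trans_le (min_le_right _ _)]⟩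
    f_computable := by
      refine uniformlyComputableOn_of_lipschitz (lipschitz_standardStep _ _)
        (F := fun p => max (ratOfCode p.2) (min (2 * ratOfCode p.2 - A (f p.1)) (B (f p.1))))
        ?_ (fun i n => by rw [hstep]; push_cast; rfl) _
      have hq : CompQ fun p : ℕ × ℕ => ratOfCode p.2 := compQ_ratOfCode.comp Computable.snd
      exact hq.max ((((CompQ.const 2).mul hq).sub (hA.comp (hf.comp Computable.fst))).min
        (hB.comp (hf.comp Computable.fst)))
    f_maps := fun i x hx => by
      rw [hstep]
      exact ⟨hx.1.trans (le_max_left _ _),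
        max_le hx.2 ((min_le_right _ _).trans (hone i).le)⟩
    f_mono := fun i x _ y _ hxy => by
      rw [hstep, hstep]
      gcongr
    f_moves := fun i x hx => by
      rw [hstep]
      exact lt_max_of_lt_right (lt_min (by linarith [hx.1]) hx.2)
    f_fixes := fun i x _ hx => by
      rw [hstep]
      refine max_eq_left ?_
      rcases le_or_gt x (A (f i)) with h | h
      · exact (min_le_left _ _).trans (by linarith)
      · exact (min_le_right _ _).trans (not_lt.1 fun h' => hx ⟨h, h'⟩) }

end StandardData

/-! ### The lift and its invariant measures -/

section Lift

theorem hasSum_half_pow_add_two : HasSum (fun i : ℕ => (1 / 2 : ℝ) ^ (i + 2)) (1 / 2) := by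
  have h := hasSum_geometric_two.mul_left (1 / 4 : ℝ)
  have e : (fun i : ℕ => (1 / 2 : ℝ) ^ (i + 2)) = fun i => 1 / 4 * (1 / 2 : ℝ) ^ i := by
    funext i
    rw [pow_add]
    ring
  rw [show (1 / 4 * 2 : ℝ) = 1 / 2 by norm_num] at h
  rw [e]
  exact h

theorem outerMap_eq {ε : ℚ} (hε : (ε : ℝ) ≤ 1 - ε) (x : ℝ) :
    outerMap ε x = max (ε : ℝ) (max x (2 * x - (1 - ε))) := by
  unfold outerMap
  split_ifs with h1 h2
  · rw [max_eq_left (max_le h1 (by linarith))]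
  · rw [max_eq_left (by linarith : 2 * x - (1 - (ε : ℝ)) ≤ x), max_eq_right (not_le.1 h1).le]
  · rw [max_eq_right (by linarith : x ≤ 2 * x - (1 - (ε : ℝ))), max_eq_right (by linarith)]

/-- The displacement of the lift. -/
noncomputable def displacement (ε : ℚ) (f : ℕ → ℝ → ℝ) (x : ℝ) : ℝ := liftMap ε f x - x

/-- The continuous lift of the circle map to the line. -/
noncomputable def lineMap (ε : ℚ) (f : ℕ → ℝ → ℝ) (x : ℝ) : ℝ :=
  x + displacement ε f (Int.fract x)

theorem lineMap_eq (ε : ℚ) (f : ℕ → ℝ → ℝ) (x : ℝ) :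
    lineMap ε f x = liftMap ε f (Int.fract x) + ⌊x⌋ := by
  unfold lineMap displacement
  linarith [Int.fract_add_floor x]

theorem lineMap_add_int (ε : ℚ) (f : ℕ → ℝ → ℝ) (x : ℝ) (m : ℤ) :
    lineMap ε f (x + m) = lineMap ε f x + m := by
  unfold lineMap
  rw [Int.fract_add_intCast]
  ring

theorem coe_int_eq_zero (m : ℤ) : ((m : ℝ) : UnitAddCircle) = 0 :=
  (AddCircle.coe_eq_zero_iff 1).2 ⟨m, by simp⟩

theorem coe_fract (x : ℝ) : ((Int.fract x : ℝ) : UnitAddCircle) = x := by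
  conv_rhs => rw [← Int.fract_add_floor x, AddCircle.coe_add, coe_int_eq_zero, add_zero]

theorem liftIco_coe {β : Type*} (F : ℝ → β) (x : ℝ) :
    AddCircle.liftIco (1 : ℝ) 0 F (x : UnitAddCircle) = F (Int.fract x) := by
  rw [← coe_fract, AddCircle.liftIco_coe_apply]
  exact ⟨Int.fract_nonneg x, by simpa using Int.fract_lt_one x⟩

theorem circleMap_coe (ε : ℚ) (f : ℕ → ℝ → ℝ) (x : ℝ) :
    circleMap ε f (x : UnitAddCircle) = (lineMap ε f x : UnitAddCircle) := by
  rw [circleMap, liftIco_coe, lineMap_eq, AddCircle.coe_add, coe_int_eq_zero, add_zero]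

theorem circleMap_iterate_coe (ε : ℚ) (f : ℕ → ℝ → ℝ) (n : ℕ) (x : ℝ) :
    (circleMap ε f)^[n] (x : UnitAddCircle) = ((lineMap ε f)^[n] x : ℝ) := by
  induction n generalizing x with
  | zero => rfl
  | succ n ih => rw [Function.iterate_succ_apply, circleMap_coe, ih, Function.iterate_succ_apply]

theorem UniformlyComputableOn.continuousOn {X Y : Type*} [MetricSpace X] [ComputableMetricSpace X]
    [MetricSpace Y] [ComputableMetricSpace Y] {f : ℕ → X → Y} {C : Set X}
    (h : UniformlyComputableOn f C) (i : ℕ) : ContinuousOn (f i) C := by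
  obtain ⟨U, ⟨E, -, hU⟩, hfU⟩ := h
  intro x hx
  rw [ContinuousWithinAt, Metric.tendsto_nhds]
  intro δ hδ
  obtain ⟨n, hn, hr⟩ := exists_mem_idealBall_radius_lt (f i x) (half_pos hδ)
  have hxU : x ∈ U (Nat.pair i n) := by
    have : x ∈ f i ⁻¹' idealBall Y n ∩ C := ⟨hn, hx⟩
    rw [hfU] at this
    exact this.1
  have hopen : IsOpen (U (Nat.pair i n)) := by
    rw [hU]
    exact isOpen_biUnion fun m _ => isOpen_idealBall m
  filter_upwards [mem_nhdsWithin_of_mem_nhds (hopen.mem_nhds hxU), self_mem_nhdsWithin] with y hy hyC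
  have hy' : y ∈ f i ⁻¹' idealBall Y n ∩ C := by
    rw [hfU]
    exact ⟨hy, hyC⟩
  have h1 := mem_idealBall.1 hy'.1
  rw [mem_idealBall] at hn
  linarith [dist_triangle_right (f i y) (f i x) (ballCenter Y n)]

/-! ### Displacement, monotonicity of the lift, and invariant measures -/

namespace IsConstruction

variable {K : Set ℝ} {a b : ℕ → ℝ} {ε : ℚ} {f : ℕ → ℝ → ℝ} (h : IsConstruction K a b ε f)

include h

theorem eps_pos : (0 : ℝ) < ε := by exact_mod_cast h.ε_pos

theorem eps_le (hK : K.Nonempty) : (ε : ℝ) ≤ 1 - ε := by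
  obtain ⟨x, hx⟩ := hK
  exact (h.margin hx).1.trans (h.margin hx).2

theorem le_f (i : ℕ) {x : ℝ} (hx : x ∈ Icc (0 : ℝ) 1) : x ≤ f i x := by
  by_cases hi : x ∈ Ioo (a i) (b i)
  · exact (h.f_moves i x hi).le
  · exact (h.f_fixes i x hx hi).ge

theorem summable {x : ℝ} (hx : x ∈ Icc (0 : ℝ) 1) :
    Summable fun i : ℕ => (1 / 2 : ℝ) ^ (i + 2) * f i x := by
  refine hasSum_half_pow_add_two.summable.of_nonneg_of_le
    (fun i => mul_nonneg (by positivity) (h.f_maps i hx).1) fun i => ?_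
  exact mul_le_of_le_one_right (by positivity) (h.f_maps i hx).2

theorem displacement_eq {x : ℝ} (hx : x ∈ Icc (0 : ℝ) 1) : displacement ε f x =
    (outerMap ε x - x) / 2 + ∑' i : ℕ, (1 / 2 : ℝ) ^ (i + 2) * (f i x - x) := by
  have h1 := (hasSum_half_pow_add_two.mul_right x)
  simp only [mul_sub]
  rw [(h.summable hx).tsum_sub h1.summable, h1.tsum_eq, displacement, liftMap]
  ring

theorem summable_sub {x : ℝ} (hx : x ∈ Icc (0 : ℝ) 1) :
    Summable fun i : ℕ => (1 / 2 : ℝ) ^ (i + 2) * (f i x - x) := by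
  simp only [mul_sub]
  exact (h.summable hx).sub (hasSum_half_pow_add_two.mul_right x).summable

theorem displacement_nonneg (hK : K.Nonempty) {x : ℝ} (hx : x ∈ Icc (0 : ℝ) 1) :
    0 ≤ displacement ε f x := by
  rw [h.displacement_eq hx]
  refine add_nonneg (div_nonneg (sub_nonneg.2 ?_) zero_le_two)
    (tsum_nonneg fun i => mul_nonneg (by positivity) (sub_nonneg.2 (h.le_f i hx)))
  rw [outerMap_eq (h.eps_le hK)]
  exact (le_max_left _ _).trans (le_max_right _ _)

/-- Outside `[ε, 1 - ε]` the outer map moves the point; inside, a point off `K` lies in some `(a i,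
b i)` and is moved by `f i`. No term moves it back. -/
theorem displacement_pos (hK : K.Nonempty) {x : ℝ} (hx : x ∈ Icc (0 : ℝ) 1) (hxK : x ∉ K) :
    0 < displacement ε f x := by
  have hε := h.eps_le hK
  have hε0 := h.eps_pos
  have hnn : ∀ i, 0 ≤ (1 / 2 : ℝ) ^ (i + 2) * (f i x - x) := fun i =>
    mul_nonneg (by positivity) (sub_nonneg.2 (h.le_f i hx))
  rw [h.displacement_eq hx, outerMap_eq hε]
  by_cases hx1 : x < ε
  · exact add_pos_of_pos_of_nonneg
      (half_pos (sub_pos.2 (hx1.trans_le (le_max_left _ _)))) (tsum_nonneg hnn)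
  by_cases hx2 : 1 - (ε : ℝ) < x
  · refine add_pos_of_pos_of_nonneg (half_pos (sub_pos.2 ?_)) (tsum_nonneg hnn)
    exact lt_of_lt_of_le (by linarith) ((le_max_right _ _).trans (le_max_right _ _))
  have hmem : x ∈ Ioo (0 : ℝ) 1 \ K := ⟨⟨by linarith, by linarith⟩, hxK⟩
  rw [h.cover] at hmem
  obtain ⟨i, hi⟩ := mem_iUnion.1 hmem
  refine add_pos_of_nonneg_of_pos (div_nonneg (sub_nonneg.2 ?_) zero_le_two)
    ((h.summable_sub hx).tsum_pos hnn i
      (mul_pos (by positivity) (sub_pos.2 (h.f_moves i x hi))))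
  exact (le_max_left _ _).trans (le_max_right _ _)

theorem displacement_eq_zero (hK : K ⊆ Icc 0 1) {x : ℝ} (hx : x ∈ K) :
    displacement ε f x = 0 := by
  have hfix : ∀ i, f i x = x := fun i => h.f_fixes i x (hK hx) fun hi => by
    have : x ∈ Ioo (0 : ℝ) 1 \ K := by
      rw [h.cover]
      exact mem_iUnion.2 ⟨i, hi⟩
    exact this.2 hx
  have hm := h.margin hx
  rw [h.displacement_eq (hK hx), outerMap_eq (h.eps_le ⟨x, hx⟩),
    max_eq_left (by linarith [hm.2] : 2 * x - (1 - (ε : ℝ)) ≤ x), max_eq_right hm.1]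
  simp [hfix]

theorem liftMap_zero : liftMap ε f 0 = ε / 2 := by
  have hfix : ∀ i, f i 0 = 0 := fun i =>
    h.f_fixes i 0 (left_mem_Icc.2 zero_le_one) fun hi => (h.a_pos i).not_gt hi.1
  simp [liftMap, outerMap, hfix, h.eps_pos.le]

theorem liftMap_one (hK : K.Nonempty) : liftMap ε f 1 = 1 + ε / 2 := by
  have hfix : ∀ i, f i 1 = 1 := fun i =>
    h.f_fixes i 1 (right_mem_Icc.2 zero_le_one) fun hi => (h.b_lt_one i).not_gt hi.2
  have hε := h.eps_le hK
  have hε0 := h.eps_pos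
  simp only [liftMap, hfix, mul_one, hasSum_half_pow_add_two.tsum_eq]
  rw [outerMap_eq hε, max_eq_right (by linarith : (1 : ℝ) ≤ 2 * 1 - (1 - ε)),
    max_eq_right (by linarith)]
  ring

theorem monotoneOn_liftMap (hK : K.Nonempty) : MonotoneOn (liftMap ε f) (Icc 0 1) := by
  intro x hx y hy hxy
  unfold liftMap
  refine add_le_add (div_le_div_of_nonneg_right ?_ zero_le_two)
    ((h.summable hx).tsum_le_tsum (fun i => ?_) (h.summable hy))
  · rw [outerMap_eq (h.eps_le hK), outerMap_eq (h.eps_le hK)]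
    gcongr
  · exact mul_le_mul_of_nonneg_left (h.f_mono i hx hy hxy) (by positivity)

theorem continuousOn_liftMap (hK : K.Nonempty) : ContinuousOn (liftMap ε f) (Icc 0 1) := by
  unfold liftMap
  refine ContinuousOn.add (Continuous.continuousOn ?_) ?_
  · simp only [outerMap_eq (h.eps_le hK)]
    fun_prop
  · refine continuousOn_tsum
      (fun i => continuousOn_const.mul (h.f_computable.continuousOn i))
      hasSum_half_pow_add_two.summable fun i x hx => ?_
    rw [Real.norm_of_nonneg (mul_nonneg (by positivity) (h.f_maps i hx).1)]
    exact mul_le_of_le_one_right (by positivity) (h.f_maps i hx).2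

/-- Both ends move by `ε / 2`; this is what makes the map close up continuously on the circle. -/
theorem displacement_zero_eq_one (hK : K.Nonempty) :
    displacement ε f 0 = displacement ε f 1 := by
  rw [displacement, displacement, h.liftMap_zero, h.liftMap_one hK]
  ring

theorem lineMap_eq_liftMap (hK : K.Nonempty) {x : ℝ} (hx : x ∈ Icc (0 : ℝ) 1) :
    lineMap ε f x = liftMap ε f x := by
  rcases hx.2.lt_or_eq with h1 | rfl
  · rw [lineMap, Int.fract_eq_self.2 ⟨hx.1, h1⟩, displacement]
    ring
  · rw [lineMap, Int.fract_one, h.displacement_zero_eq_one hK, displacement]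
    ring

theorem circleMap_coe_eq_liftMap (hK : K.Nonempty) {x : ℝ} (hx : x ∈ Icc (0 : ℝ) 1) :
    circleMap ε f (x : UnitAddCircle) = (liftMap ε f x : UnitAddCircle) := by
  rw [circleMap_coe, h.lineMap_eq_liftMap hK hx]

theorem continuous_lineMap (hK : K.Nonempty) : Continuous (lineMap ε f) :=
  continuous_id.add (ContinuousOn.comp_fract'' ((h.continuousOn_liftMap hK).sub continuousOn_id)
    (h.displacement_zero_eq_one hK))

theorem monotone_lineMap (hK : K.Nonempty) : Monotone (lineMap ε f) := by
  have hfr : ∀ x : ℝ, Int.fract x ∈ Icc (0 : ℝ) 1 := fun x =>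
    ⟨Int.fract_nonneg x, (Int.fract_lt_one x).le⟩
  intro x y hxy
  rcases (Int.floor_mono hxy).eq_or_lt with he | hl
  · rw [lineMap_eq, lineMap_eq, he]
    refine add_le_add_left (h.monotoneOn_liftMap hK (hfr x) (hfr y) ?_) _
    unfold Int.fract
    rw [he]
    linarith
  -- When an integer separates the points, the values are compared through the two ends: at most `1
  -- + ε / 2` on the left, at least `ε / 2` on the right, and the floors differ by at least one.
  · rw [lineMap_eq, lineMap_eq]
    have h0 := h.monotoneOn_liftMap hK (left_mem_Icc.2 zero_le_one) (hfr y) (hfr y).1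
    have h1 := h.monotoneOn_liftMap hK (hfr x) (right_mem_Icc.2 zero_le_one) (hfr x).2
    rw [h.liftMap_zero] at h0
    rw [h.liftMap_one hK] at h1
    have h2 : (⌊x⌋ : ℝ) + 1 ≤ ⌊y⌋ := by exact_mod_cast hl
    linarith

/-- The translates `p + m` of a point `p` of `K` are fixed. One lies in `[x, x + 1)`, and
monotonicity keeps the orbit of `x` below it. -/
theorem lineMap_iterate_le (hK : IsSeedSet K) (n : ℕ) (x : ℝ) :
    (lineMap ε f)^[n] x ≤ x + 1 := by
  obtain ⟨p, hp⟩ := hK.nonempty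
  have hfix : ∀ m : ℤ, Function.IsFixedPt (lineMap ε f) (p + m) := fun m => by
    rw [Function.IsFixedPt, lineMap_add_int, h.lineMap_eq_liftMap hK.nonempty (hK.subset hp)]
    have := h.displacement_eq_zero hK.subset hp
    rw [displacement] at this
    linarith
  have h1 : x ≤ p + (⌈x - p⌉ : ℤ) := by linarith [Int.le_ceil (x - p)]
  have h2 := (h.monotone_lineMap hK.nonempty).iterate n h1
  rw [((hfix _).iterate n).eq] at h2
  linarith [Int.ceil_lt_add_one (x - p)]

theorem sum_displacement_le (hK : IsSeedSet K) (n : ℕ) (x : ℝ) :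
    ∑ k ∈ Finset.range n, displacement ε f (Int.fract ((lineMap ε f)^[k] x)) ≤ 1 := by
  have hs : ∑ k ∈ Finset.range n, displacement ε f (Int.fract ((lineMap ε f)^[k] x)) =
      (lineMap ε f)^[n] x - x := by
    induction n with
    | zero => simp
    | succ n ih =>
      rw [Finset.sum_range_succ, ih, Function.iterate_succ_apply']
      have e : lineMap ε f ((lineMap ε f)^[n] x) = (lineMap ε f)^[n] x +
          displacement ε f (Int.fract ((lineMap ε f)^[n] x)) := rfl
      rw [e]
      ring
  rw [hs]
  linarith [h.lineMap_iterate_le hK n x]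

/-- The displacements along an orbit telescope to at most `1`, while by invariance each has the same
integral. Hence that integral is zero, and the displacement is positive off `K`. -/
theorem measure_compl_eq_zero (hK : IsSeedSet K) (μ : Measure UnitAddCircle)
    [IsProbabilityMeasure μ] (hμ : MeasurePreserving (circleMap ε f) μ μ) :
    μ (((↑) : ℝ → UnitAddCircle) '' K)ᶜ = 0 := by
  set D : UnitAddCircle → ℝ := AddCircle.liftIco (1 : ℝ) 0 (displacement ε f)
  have hDcoe : ∀ x : ℝ, D x = displacement ε f (Int.fract x) := fun x => liftIco_coe _ x
  have hfr : ∀ x : ℝ, Int.fract x ∈ Icc (0 : ℝ) 1 := fun x =>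
    ⟨Int.fract_nonneg x, (Int.fract_lt_one x).le⟩
  have hD : Continuous D := by
    refine AddCircle.liftIco_continuous ?_ ?_
    · simpa using h.displacement_zero_eq_one hK.nonempty
    · rw [zero_add]
      exact (h.continuousOn_liftMap hK.nonempty).sub continuousOn_id
  have hDm : Measurable fun z => ENNReal.ofReal (D z) := hD.measurable.ennreal_ofReal
  have hint : ∀ n : ℕ, n * ∫⁻ z, ENNReal.ofReal (D z) ∂μ ≤ 1 := by
    intro n
    have h1 : ∀ k : ℕ, ∫⁻ z, ENNReal.ofReal (D ((circleMap ε f)^[k] z)) ∂μ =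
        ∫⁻ z, ENNReal.ofReal (D z) ∂μ := fun k => (hμ.iterate k).lintegral_comp hDm
    calc n * ∫⁻ z, ENNReal.ofReal (D z) ∂μ
        = ∑ k ∈ Finset.range n, ∫⁻ z, ENNReal.ofReal (D ((circleMap ε f)^[k] z)) ∂μ := by
          simp [h1]
      _ = ∫⁻ z, ∑ k ∈ Finset.range n, ENNReal.ofReal (D ((circleMap ε f)^[k] z)) ∂μ :=
          (lintegral_finsetSum _ fun k _ => hDm.comp (hμ.iterate k).measurable).symm
      _ ≤ ∫⁻ _, 1 ∂μ := by
          refine lintegral_mono fun z => ?_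
          obtain ⟨x, rfl⟩ := QuotientAddGroup.mk_surjective z
          change ∑ k ∈ Finset.range n, ENNReal.ofReal (D ((circleMap ε f)^[k] (x : UnitAddCircle)))
            ≤ 1
          simp only [circleMap_iterate_coe, hDcoe]
          rw [← ENNReal.ofReal_sum_of_nonneg fun k _ =>
            h.displacement_nonneg hK.nonempty (hfr _), ← ENNReal.ofReal_one]
          exact ENNReal.ofReal_le_ofReal (h.sum_displacement_le hK n x)
      _ = 1 := by simp
  have hzero : ∫⁻ z, ENNReal.ofReal (D z) ∂μ = 0 := by
    by_contra h0
    obtain ⟨n, hn⟩ := ENNReal.exists_nat_mul_gt h0 ENNReal.one_ne_top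
    exact (hint n).not_gt hn
  rw [lintegral_eq_zero_iff hDm] at hzero
  refine measure_mono_null (fun z hz => ?_) (ae_iff.1 hzero)
  obtain ⟨x, rfl⟩ := QuotientAddGroup.mk_surjective z
  change ¬ ENNReal.ofReal (D (x : UnitAddCircle)) = 0
  rw [hDcoe, ENNReal.ofReal_eq_zero, not_le]
  refine h.displacement_pos hK.nonempty (hfr x) fun hx => hz ⟨_, hx, coe_fract x⟩

end IsConstruction

end Lift

/-! ### Computability of the circle map -/

section CircleComputable

/-- The real number in `[0, ∞)` whose class is the centre of the `n`-th ideal ball of the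
circle. -/
def circleCenter (n : ℕ) : ℚ := (n.unpair.1.unpair.1 : ℚ) / (n.unpair.1.unpair.2 + 1)

theorem compQ_circleCenter : CompQ circleCenter := by
  have hu := Computable.unpair.comp (Computable.fst.comp Computable.unpair)
  exact (CompQ.of_frac (Computable.fst.comp hu) (Computable.const 0)
    (Computable.snd.comp hu)).of_eq fun n => by simp [circleCenter]

theorem ballCenter_circle (n : ℕ) :
    ballCenter UnitAddCircle n = ((circleCenter n : ℝ) : UnitAddCircle) := by
  unfold circleCenter
  push_cast
  rfl

theorem circle_dist_lt_iff (x y r : ℝ) :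
    dist (x : UnitAddCircle) y < r ↔ ∃ m : ℤ, |x - y - m| < r := by
  rw [dist_eq_norm, ← AddCircle.coe_sub, UnitAddCircle.norm_eq]
  exact ⟨fun h => ⟨_, h⟩, fun ⟨m, hm⟩ => (round_le _ m).trans_lt hm⟩

theorem coe_mem_idealBall_circle_iff (x : ℝ) (n : ℕ) :
    (x : UnitAddCircle) ∈ idealBall UnitAddCircle n ↔
      ∃ m : ℤ, |x - circleCenter n - m| < ballRadius n := by
  rw [mem_idealBall, ballCenter_circle, circle_dist_lt_iff]

/-- Circle centres are named by nonnegative rationals; for `x > 0` one can be taken just below `x`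
on the line, with no integer shift. -/
theorem exists_circle_ball {x : ℝ} (hx : 0 < x) {η : ℝ} (hη : 0 < η) :
    ∃ n, |x - circleCenter n| < ballRadius n ∧ (ballRadius n : ℝ) < η := by
  obtain ⟨δ, hδ0, hδ⟩ := exists_rat_btwn hη
  obtain ⟨q, hq1, hq2⟩ := exists_rat_btwn
    (max_lt hx (sub_lt_self x hδ0) : max 0 (x - δ) < x)
  have hq0 : (0 : ℚ) < q := by exact_mod_cast (le_max_left _ _).trans_lt hq1
  obtain ⟨i, rfl⟩ := exists_posRatOfCode hq0
  obtain ⟨j, rfl⟩ := exists_posRatOfCode (show (0 : ℚ) < δ by exact_mod_cast hδ0)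
  refine ⟨Nat.pair (Nat.pair (i.unpair.1 + 1) i.unpair.2) j, ?_, by simpa [ballRadius] using hδ⟩
  have h1 : circleCenter (Nat.pair (Nat.pair (i.unpair.1 + 1) i.unpair.2) j) = posRatOfCode i := by
    simp [circleCenter, posRatOfCode]
  have h2 := (le_max_right _ _).trans_lt hq1
  rw [h1, abs_of_pos (sub_pos.2 hq2)]
  simp only [ballRadius, Nat.unpair_pair]
  linarith

namespace IsConstruction

variable {K : Set ℝ} {a b : ℕ → ℝ} {ε : ℚ} {f : ℕ → ℝ → ℝ} (h : IsConstruction K a b ε f)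

include h

/-- The approximation is the centre of a ball of radius below `2^(-k)` found to contain the value.
-/
theorem exists_f_approx : ∃ W : (ℕ × ℕ) × ℕ → ℚ, CompQ W ∧
    ∀ i t k, (ratOfCode t : ℝ) ∈ Icc (0 : ℝ) 1 →
      |f i (ratOfCode t) - W ((i, t), k)| < (1 / 2 : ℝ) ^ k := by
  obtain ⟨U, ⟨E, hE, hU⟩, hfU⟩ := h.f_computable
  have hi : Computable fun x : ((ℕ × ℕ) × ℕ) × ℕ => x.1.1.1 :=
    Computable.fst.comp (Computable.fst.comp Computable.fst)
  have ht : Computable fun x : ((ℕ × ℕ) × ℕ) × ℕ => x.1.1.2 :=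
    Computable.snd.comp (Computable.fst.comp Computable.fst)
  have hq : CompQ fun x : ((ℕ × ℕ) × ℕ) × ℕ => ratOfCode x.1.1.2 := compQ_ratOfCode.comp ht
  have hmem : REPred fun x : ((ℕ × ℕ) × ℕ) × ℕ =>
      ∃ j, E (Nat.pair x.1.1.1 x.2, j) ∧ (ratOfCode x.1.1.2 : ℝ) ∈ idealBall ℝ j :=
    REPred.exists_nat (p := fun y : (((ℕ × ℕ) × ℕ) × ℕ) × ℕ =>
        E (Nat.pair y.1.1.1.1 y.1.2, y.2) ∧ (ratOfCode y.1.1.1.2 : ℝ) ∈ idealBall ℝ y.2)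
      ((REPred.comp hE (((hi.comp Computable.fst).natPair
        (Computable.snd.comp Computable.fst)).pair Computable.snd)).and
      (computablePred_ratCast_mem_idealBall (hq.comp Computable.fst) Computable.snd).to_re)
  -- Arguments outside `[0,1]`, a decidable case, accept any answer; this makes the relation total,
  -- as uniformization requires.
  have hre : REPred fun x : ((ℕ × ℕ) × ℕ) × ℕ =>
      (ratOfCode x.1.1.2 < 0 ∨ 1 < ratOfCode x.1.1.2) ∨
      ((∃ j, E (Nat.pair x.1.1.1 x.2, j) ∧ (ratOfCode x.1.1.2 : ℝ) ∈ idealBall ℝ j) ∧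
        ballRadius x.2 < (1 / 2) ^ x.1.2) :=
    ((hq.lt (CompQ.const 0)).to_re.or ((CompQ.const 1).lt hq).to_re).or
      (hmem.and ((compQ_ballRadius.comp Computable.snd).lt
        (CompQ.half_pow (Computable.snd.comp Computable.fst))).to_re)
  have hiff : ∀ i t n, (ratOfCode t : ℝ) ∈ Icc (0 : ℝ) 1 →
      ((∃ j, E (Nat.pair i n, j) ∧ (ratOfCode t : ℝ) ∈ idealBall ℝ j) ↔
        f i (ratOfCode t) ∈ idealBall ℝ n) := by
    intro i t n ht
    have h1 : (ratOfCode t : ℝ) ∈ f i ⁻¹' idealBall ℝ n ∩ Icc 0 1 ↔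
        (ratOfCode t : ℝ) ∈ U (Nat.pair i n) ∩ Icc 0 1 := by rw [hfU]
    rw [mem_inter_iff, mem_inter_iff, and_iff_left ht, and_iff_left ht, hU, mem_preimage] at h1
    rw [h1]
    simp
  obtain ⟨g, hg, hgR⟩ := REPred.exists_computable hre fun x => by
    by_cases h0 : ratOfCode x.1.2 < 0
    · exact ⟨0, Or.inl (Or.inl h0)⟩
    by_cases h1 : 1 < ratOfCode x.1.2
    · exact ⟨0, Or.inl (Or.inr h1)⟩
    have hx : (ratOfCode x.1.2 : ℝ) ∈ Icc (0 : ℝ) 1 :=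
      ⟨by exact_mod_cast not_lt.1 h0, by exact_mod_cast not_lt.1 h1⟩
    obtain ⟨n, hn, hr⟩ := exists_mem_idealBall_radius_lt (f x.1.1 (ratOfCode x.1.2))
      (show (0 : ℝ) < (1 / 2) ^ x.2 by positivity)
    refine ⟨n, Or.inr ⟨(hiff _ _ _ hx).2 hn, ?_⟩⟩
    rw [← Rat.cast_lt (K := ℝ)]
    push_cast
    exact hr
  refine ⟨fun x => ratOfCode (g x).unpair.1, compQ_center.comp hg, fun i t k ht => ?_⟩
  rcases hgR ((i, t), k) with (h0 | h1) | ⟨h2, h3⟩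
  · have h0' : (ratOfCode t : ℝ) < 0 := by exact_mod_cast h0
    exact absurd ht.1 (not_le.2 h0')
  · have h1' : (1 : ℝ) < ratOfCode t := by exact_mod_cast h1
    exact absurd ht.2 (not_le.2 h1')
  · have h4 := (hiff _ _ _ ht).1 h2
    rw [mem_idealBall, ballCenter_real, Real.dist_eq] at h4
    have h5 := (Rat.cast_lt (K := ℝ)).2 h3
    push_cast at h5
    exact h4.trans h5

/-- Keep `k + 1` terms, each `f i` known up to `2^(-k-1)`. As the weights sum to `1/2` and `0 ≤ f i
≤ 1`, the tail and the finite part each contribute an error of at most half of `2^(-k-1)`. -/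
theorem exists_liftMap_approx (hK : K.Nonempty) : ∃ V : ℕ × ℕ → ℚ, CompQ V ∧
    ∀ t k, (ratOfCode t : ℝ) ∈ Icc (0 : ℝ) 1 →
      |liftMap ε f (ratOfCode t) - V (t, k)| ≤ (1 / 2 : ℝ) ^ k := by
  obtain ⟨W, hW, hWf⟩ := h.exists_f_approx
  have hq : CompQ fun p : ℕ × ℕ => ratOfCode p.1 := compQ_ratOfCode.comp Computable.fst
  have hterm : CompQ fun x : (ℕ × ℕ) × ℕ =>
      (1 / 2 : ℚ) ^ (x.2 + 2) * W ((x.2, x.1.1), x.1.2 + 1) :=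
    (CompQ.half_pow (Computable.natAdd Computable.snd (Computable.const 2))).mul
      (hW.comp ((Computable.snd.pair (Computable.fst.comp Computable.fst)).pair
        (Computable.succ.comp (Computable.snd.comp Computable.fst))))
  refine ⟨fun p => max ε (max (ratOfCode p.1) (2 * ratOfCode p.1 - (1 - ε))) * (1 / 2) +
    ∑ i ∈ Finset.range (p.2 + 1), (1 / 2) ^ (i + 2) * W ((i, p.1), p.2 + 1), ?_, ?_⟩
  · exact (((CompQ.const ε).max (hq.max (((CompQ.const 2).mul hq).sub
      (CompQ.const (1 - ε))))).mul (CompQ.const (1 / 2))).add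
        (CompQ.sum_range hterm (Computable.succ.comp Computable.snd))
  · intro t k ht
    have hsum := h.summable ht
    have hsplit := hsum.sum_add_tsum_nat_add (k + 1)
    have htail0 : 0 ≤ ∑' i : ℕ, (1 / 2 : ℝ) ^ (i + (k + 1) + 2) *
        f (i + (k + 1)) (ratOfCode t) :=
      tsum_nonneg fun i => mul_nonneg (by positivity) (h.f_maps _ ht).1
    have hgeo : HasSum (fun i : ℕ => (1 / 2 : ℝ) ^ (i + (k + 1) + 2))
        ((1 / 2 : ℝ) ^ (k + 1) * (1 / 2)) := by
      have e : (fun i : ℕ => (1 / 2 : ℝ) ^ (i + (k + 1) + 2)) =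
          fun i => (1 / 2 : ℝ) ^ (k + 1) * (1 / 2 : ℝ) ^ (i + 2) := by
        funext i
        rw [← pow_add]
        congr 1
        ring
      rw [e]
      exact hasSum_half_pow_add_two.mul_left _
    have htail1 : ∑' i : ℕ, (1 / 2 : ℝ) ^ (i + (k + 1) + 2) * f (i + (k + 1)) (ratOfCode t) ≤
        (1 / 2 : ℝ) ^ (k + 1) * (1 / 2) := by
      rw [← hgeo.tsum_eq]
      exact ((summable_nat_add_iff (k + 1)).2 hsum).tsum_le_tsum
        (fun i => mul_le_of_le_one_right (by positivity) (h.f_maps _ ht).2) hgeo.summable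
    have hfin : |∑ i ∈ Finset.range (k + 1), (1 / 2 : ℝ) ^ (i + 2) * f i (ratOfCode t) -
        ∑ i ∈ Finset.range (k + 1), (1 / 2 : ℝ) ^ (i + 2) * (W ((i, t), k + 1) : ℝ)| ≤
        (1 / 2) * (1 / 2 : ℝ) ^ (k + 1) := by
      rw [← Finset.sum_sub_distrib]
      refine (Finset.abs_sum_le_sum_abs _ _).trans ?_
      have h1 : ∑ i ∈ Finset.range (k + 1), (1 / 2 : ℝ) ^ (i + 2) ≤ 1 / 2 :=
        sum_le_hasSum _ (fun i _ => by positivity) hasSum_half_pow_add_two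
      refine le_trans ?_ (mul_le_mul_of_nonneg_right h1 (by positivity))
      rw [Finset.sum_mul]
      refine Finset.sum_le_sum fun i _ => ?_
      rw [← mul_sub, abs_mul, abs_of_pos (by positivity)]
      exact mul_le_mul_of_nonneg_left (hWf i t (k + 1) ht).le (by positivity)
    rw [liftMap, outerMap_eq (h.eps_le hK), ← hsplit]
    push_cast
    rw [abs_le] at *
    rw [pow_succ] at *
    constructor <;> linarith [hfin.1, hfin.2]

/-- The lift has uniformly computable values at the rationals. -/
theorem rePred_lineMap (hK : K.Nonempty) :
    (REPred fun p : ℕ × ℕ => (ratOfCode p.2 : ℝ) < lineMap ε f (ratOfCode p.1)) ∧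
    REPred fun p : ℕ × ℕ => lineMap ε f (ratOfCode p.1) < (ratOfCode p.2 : ℝ) := by
  obtain ⟨V, hV, hVf⟩ := h.exists_liftMap_approx hK
  -- a witness `((i, j), (t, k))`: the point is `t + (i - j)`, and `k` is the precision
  have hx : CompQ fun x : (ℕ × ℕ) × ((ℕ × ℕ) × (ℕ × ℕ)) => ratOfCode x.1.1 :=
    compQ_ratOfCode.comp (Computable.fst.comp Computable.fst)
  have hu : CompQ fun x : (ℕ × ℕ) × ((ℕ × ℕ) × (ℕ × ℕ)) => ratOfCode x.1.2 :=
    compQ_ratOfCode.comp (Computable.snd.comp Computable.fst)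
  have ht : CompQ fun x : (ℕ × ℕ) × ((ℕ × ℕ) × (ℕ × ℕ)) => ratOfCode x.2.2.1 :=
    compQ_ratOfCode.comp (Computable.fst.comp (Computable.snd.comp Computable.snd))
  have hm : CompQ fun x : (ℕ × ℕ) × ((ℕ × ℕ) × (ℕ × ℕ)) =>
      ((x.2.1.1 : ℚ) - (x.2.1.2 : ℚ)) :=
    (CompQ.nat (Computable.fst.comp (Computable.fst.comp Computable.snd))).sub
      (CompQ.nat (Computable.snd.comp (Computable.fst.comp Computable.snd)))
  have hv : CompQ fun x : (ℕ × ℕ) × ((ℕ × ℕ) × (ℕ × ℕ)) => V x.2.2 :=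
    hV.comp (Computable.snd.comp Computable.snd)
  have hk : CompQ fun x : (ℕ × ℕ) × ((ℕ × ℕ) × (ℕ × ℕ)) => (1 / 2 : ℚ) ^ x.2.2.2 :=
    CompQ.half_pow (Computable.snd.comp (Computable.snd.comp Computable.snd))
  have hdom : REPred fun x : (ℕ × ℕ) × ((ℕ × ℕ) × (ℕ × ℕ)) =>
      ((0 ≤ ratOfCode x.2.2.1 ∧ ratOfCode x.2.2.1 ≤ 1) ∧
        (ratOfCode x.1.1 ≤ ratOfCode x.2.2.1 + ((x.2.1.1 : ℚ) - (x.2.1.2 : ℚ)) ∧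
        ratOfCode x.2.2.1 + ((x.2.1.1 : ℚ) - (x.2.1.2 : ℚ)) ≤ ratOfCode x.1.1)) :=
    ((((CompQ.const 0).le ht).to_re).and (ht.le (CompQ.const 1)).to_re).and
      ((hx.le (ht.add hm)).to_re.and ((ht.add hm).le hx).to_re)
  -- The representation need not be unique: `t = 0` and `t = 1` both occur, but the lift agrees with
  -- `liftMap` on the closed interval.
  have hval : ∀ (x i j t : ℕ), ((0 ≤ ratOfCode t ∧ ratOfCode t ≤ 1) ∧
      (ratOfCode x ≤ ratOfCode t + ((i : ℚ) - (j : ℚ)) ∧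
        ratOfCode t + ((i : ℚ) - (j : ℚ)) ≤ ratOfCode x)) →
      (ratOfCode t : ℝ) ∈ Icc (0 : ℝ) 1 ∧
      lineMap ε f (ratOfCode x) = liftMap ε f (ratOfCode t) + ((i : ℝ) - j) := by
    rintro x i j t ⟨⟨h0, h1⟩, h2, h3⟩
    have h01 : (ratOfCode t : ℝ) ∈ Icc (0 : ℝ) 1 := ⟨by exact_mod_cast h0, by exact_mod_cast h1⟩
    refine ⟨h01, ?_⟩
    rw [le_antisymm h2 h3, ← h.lineMap_eq_liftMap hK h01]
    have := lineMap_add_int ε f (ratOfCode t) ((i : ℤ) - j)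
    push_cast at this ⊢
    exact this
  have hwit : ∀ x : ℕ, ∃ i j t : ℕ, ((0 ≤ ratOfCode t ∧ ratOfCode t ≤ 1) ∧
      (ratOfCode x ≤ ratOfCode t + ((i : ℚ) - (j : ℚ)) ∧
        ratOfCode t + ((i : ℚ) - (j : ℚ)) ≤ ratOfCode x)) := by
    intro x
    obtain ⟨t, ht⟩ := ratOfCode_surjective (Int.fract (ratOfCode x))
    have e : ((⌊ratOfCode x⌋.toNat : ℚ) - ((-⌊ratOfCode x⌋).toNat : ℚ)) = ⌊ratOfCode x⌋ := by
      have : ((⌊ratOfCode x⌋.toNat : ℤ) - ((-⌊ratOfCode x⌋).toNat : ℤ)) = ⌊ratOfCode x⌋ := by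
        omega
      exact_mod_cast this
    refine ⟨⌊ratOfCode x⌋.toNat, (-⌊ratOfCode x⌋).toNat, t, ?_⟩
    rw [ht, e, Int.fract_add_floor]
    exact ⟨⟨Int.fract_nonneg _, (Int.fract_lt_one _).le⟩, le_rfl, le_rfl⟩
  constructor
  · refine (REPred.exists (hdom.and ((hu.add hk).lt (hv.add hm)).to_re)).of_eq fun p => ?_
    constructor
    · rintro ⟨⟨⟨i, j⟩, t, k⟩, hd, hlt⟩
      obtain ⟨h01, hl⟩ := hval _ _ _ _ hd
      have h1 := (abs_le.1 (hVf t k h01)).1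
      have h2 := (Rat.cast_lt (K := ℝ)).2 hlt
      push_cast at h2
      rw [hl]
      linarith
    · intro hp
      obtain ⟨i, j, t, hd⟩ := hwit p.1
      obtain ⟨h01, hl⟩ := hval _ _ _ _ hd
      obtain ⟨k, hk⟩ := exists_pow_lt_of_lt_one (half_pos (sub_pos.2 hp))
        (show (1 / 2 : ℝ) < 1 by norm_num)
      refine ⟨((i, j), (t, k)), hd, ?_⟩
      have h1 := (abs_le.1 (hVf t k h01)).2
      rw [← Rat.cast_lt (K := ℝ)]
      push_cast
      rw [hl] at hk
      linarith
  · refine (REPred.exists (hdom.and ((hv.add hm).lt (hu.sub hk)).to_re)).of_eq fun p => ?_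
    constructor
    · rintro ⟨⟨⟨i, j⟩, t, k⟩, hd, hlt⟩
      obtain ⟨h01, hl⟩ := hval _ _ _ _ hd
      have h1 := (abs_le.1 (hVf t k h01)).2
      have h2 := (Rat.cast_lt (K := ℝ)).2 hlt
      push_cast at h2
      rw [hl]
      linarith
    · intro hp
      obtain ⟨i, j, t, hd⟩ := hwit p.1
      obtain ⟨h01, hl⟩ := hval _ _ _ _ hd
      obtain ⟨k, hk⟩ := exists_pow_lt_of_lt_one (half_pos (sub_pos.2 hp))
        (show (1 / 2 : ℝ) < 1 by norm_num)
      refine ⟨((i, j), (t, k)), hd, ?_⟩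
      have h1 := (abs_le.1 (hVf t k h01)).1
      rw [← Rat.cast_lt (K := ℝ)]
      push_cast
      rw [hl] at hk
      linarith

/-- A source ball is accepted when the lift sends both of its rational endpoints strictly inside one
integer translate of the target interval; by monotonicity the whole ball follows. The integer is
coded as a difference of naturals. -/
theorem isComputableMap_circleMap (hK : K.Nonempty) : IsComputableMap (circleMap ε f) := by
  obtain ⟨hlow, hup⟩ := h.rePred_lineMap hK
  have hcomp : ∀ {α : Type} [Primcodable α] {F G : α → ℚ}, CompQ F → CompQ G →
      (REPred fun x => (G x : ℝ) < lineMap ε f (F x)) ∧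
        REPred fun x => lineMap ε f (F x) < (G x : ℝ) := by
    rintro α _ F G ⟨F', hF', hF⟩ ⟨G', hG', hG⟩
    exact ⟨REPred.comp hlow (hF'.pair hG') fun x => by rw [hF, hG],
      REPred.comp hup (hF'.pair hG') fun x => by rw [hF, hG]⟩
  have hc : CompQ fun x : (ℕ × ℕ) × (ℕ × ℕ) => circleCenter x.1.1 :=
    compQ_circleCenter.comp (Computable.fst.comp Computable.fst)
  have hr : CompQ fun x : (ℕ × ℕ) × (ℕ × ℕ) => ballRadius x.1.1 :=
    compQ_ballRadius.comp (Computable.fst.comp Computable.fst)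
  have hs : CompQ fun x : (ℕ × ℕ) × (ℕ × ℕ) => circleCenter x.1.2 :=
    compQ_circleCenter.comp (Computable.snd.comp Computable.fst)
  have hd : CompQ fun x : (ℕ × ℕ) × (ℕ × ℕ) => ballRadius x.1.2 :=
    compQ_ballRadius.comp (Computable.snd.comp Computable.fst)
  have hm : CompQ fun x : (ℕ × ℕ) × (ℕ × ℕ) => ((x.2.1 : ℚ) - (x.2.2 : ℚ)) :=
    (CompQ.nat (Computable.fst.comp Computable.snd)).sub
      (CompQ.nat (Computable.snd.comp Computable.snd))
  have hre := REPred.exists (((hcomp (hs.sub hd) ((hc.sub hr).add hm)).1).and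
    (hcomp (hs.add hd) ((hc.add hr).add hm)).2)
  refine ⟨_, hre, fun n => ?_⟩
  ext z
  obtain ⟨x, rfl⟩ : ∃ x : ℝ, (x : UnitAddCircle) = z := QuotientAddGroup.mk_surjective z
  rw [mem_preimage, circleMap_coe, coe_mem_idealBall_circle_iff]
  simp only [mem_iUnion₂, mem_ofPred_eq]
  push_cast
  constructor
  · rintro ⟨m, hmx⟩
    -- move the point to the positive half line
    obtain ⟨l, hl⟩ : ∃ l : ℤ, 0 < x + l := ⟨⌈-x⌉ + 1, by push_cast; linarith [Int.le_ceil (-x)]⟩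
    have hopen : IsOpen {y | |lineMap ε f y - circleCenter n - (m + l : ℤ)| < ballRadius n} :=
      isOpen_lt (((h.continuous_lineMap hK).sub continuous_const).sub continuous_const).abs
        continuous_const
    have hxl : x + l ∈ {y | |lineMap ε f y - circleCenter n - (m + l : ℤ)| < ballRadius n} := by
      rw [mem_ofPred_eq, lineMap_add_int]
      push_cast
      convert! hmx using 2
      ring
    obtain ⟨η, hη, hball⟩ := Metric.isOpen_iff.1 hopen _ hxl
    -- With radius below `η / 2` the closed ball stays within `η` of the point, so its endpoints may
    -- be tested.
    obtain ⟨j, hj, hjη⟩ := exists_circle_ball hl (half_pos hη)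
    have hmemj : ∀ y : ℝ, |y - circleCenter j| ≤ ballRadius j →
        |lineMap ε f y - circleCenter n - (m + l : ℤ)| < ballRadius n := by
      intro y hy
      refine hball ?_
      rw [Metric.mem_ball, Real.dist_eq]
      rw [abs_lt] at hj ⊢
      rw [abs_le] at hy
      constructor <;> linarith
    have hr0 := ballRadius_pos' j
    have h1 := abs_lt.1 (hmemj (circleCenter j - ballRadius j)
      (by rw [sub_sub_cancel_left, abs_neg, abs_of_pos hr0]))
    have h2 := abs_lt.1 (hmemj (circleCenter j + ballRadius j)
      (by rw [add_sub_cancel_left, abs_of_pos hr0]))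
    have e : (((m + l).toNat : ℝ) - ((-(m + l)).toNat : ℝ)) = (m + l : ℤ) := by
      have : (((m + l).toNat : ℤ) - ((-(m + l)).toNat : ℤ)) = m + l := by omega
      exact_mod_cast this
    refine ⟨j, ⟨((m + l).toNat, (-(m + l)).toNat), ?_, ?_⟩, ?_⟩
    · rw [e]
      linarith
    · rw [e]
      linarith
    · rw [coe_mem_idealBall_circle_iff]
      refine ⟨-l, ?_⟩
      push_cast
      convert! hj using 2
      ring
  · rintro ⟨j, ⟨⟨p, q⟩, h1, h2⟩, hx⟩
    obtain ⟨l, hl⟩ := (coe_mem_idealBall_circle_iff _ _).1 hx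
    rw [abs_lt] at hl
    have hmono := h.monotone_lineMap hK
    have h3 := hmono (show (circleCenter j : ℝ) - ballRadius j ≤ x + (-l : ℤ) by
      push_cast; linarith)
    have h4 := hmono (show x + (-l : ℤ) ≤ (circleCenter j : ℝ) + ballRadius j by
      push_cast; linarith)
    rw [lineMap_add_int] at h3 h4
    refine ⟨(p : ℤ) - q + l, ?_⟩
    push_cast at *
    rw [abs_lt]
    constructor <;> linarith

end IsConstruction

end CircleComputable

/-! ### Absence of computable invariant measures -/

section NoComputableMeasure

/-- Only circle balls whose interval lies in `[0,1]` are used: for `x` in `(0,1)`, membership in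
such a ball leaves no integer shift but `0`, so it locates `x` on the line. -/
theorem IsComputablePoint.of_circle {x : ℝ} (hx : x ∈ Ioo (0 : ℝ) 1)
    (h : IsComputablePoint (x : UnitAddCircle)) : IsComputablePoint x := by
  have hs : CompQ fun p : ℕ × ℕ => circleCenter p.2 := compQ_circleCenter.comp Computable.snd
  have hd : CompQ fun p : ℕ × ℕ => ballRadius p.2 := compQ_ballRadius.comp Computable.snd
  have hre : REPred fun p : ℕ × ℕ => (x : UnitAddCircle) ∈ idealBall UnitAddCircle p.2 ∧
      (0 ≤ circleCenter p.2 - ballRadius p.2 ∧ circleCenter p.2 + ballRadius p.2 ≤ 1) ∧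
      |circleCenter p.2 - ratOfCode p.1.unpair.1| + ballRadius p.2 ≤ ballRadius p.1 :=
    (REPred.comp h Computable.snd).and ((((CompQ.const 0).le (hs.sub hd)).to_re.and
      ((hs.add hd).le (CompQ.const 1)).to_re).and
      (((hs.sub (compQ_center.comp Computable.fst)).abs.add hd).le
        (compQ_ballRadius.comp Computable.fst)).to_re)
  refine (REPred.exists_nat hre).of_eq fun n => ?_
  dsimp only
  simp only [← Rat.cast_le (K := ℝ)]
  push_cast
  rw [mem_idealBall, ballCenter_real, Real.dist_eq]
  constructor
  · rintro ⟨j, hj, ⟨h0, h1⟩, hin⟩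
    obtain ⟨m, hm⟩ := (coe_mem_idealBall_circle_iff _ _).1 hj
    have hm' := abs_lt.1 hm
    have hm1 : (m : ℝ) < 1 := by linarith [hx.2]
    have hm2 : (-1 : ℝ) < m := by linarith [hx.1]
    have hm0 : m = 0 := by
      have h1 : m < 1 := by exact_mod_cast hm1
      have h2 : -1 < m := by exact_mod_cast hm2
      omega
    rw [hm0, Int.cast_zero, sub_zero] at hm
    linarith [abs_sub_le x (circleCenter j : ℝ) (ratOfCode n.unpair.1)]
  · intro hn
    obtain ⟨j, hj, hr⟩ := exists_circle_ball hx.1 (half_pos (lt_min (lt_min hx.1 (sub_pos.2 hx.2))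
      (sub_pos.2 hn)))
    have hmin1 := (min_le_left (min x (1 - x)) (ballRadius n - |x - ratOfCode n.unpair.1|))
    have hmin2 := (min_le_right (min x (1 - x)) (ballRadius n - |x - ratOfCode n.unpair.1|))
    have hmin3 := min_le_left x (1 - x)
    have hmin4 := min_le_right x (1 - x)
    have hj' := abs_lt.1 hj
    refine ⟨j, (coe_mem_idealBall_circle_iff _ _).2 ⟨0, by simpa using hj⟩,
      ⟨by linarith, by linarith⟩, ?_⟩
    have := abs_sub_le (circleCenter j : ℝ) x (ratOfCode n.unpair.1)
    rw [abs_sub_comm (circleCenter j : ℝ) x] at this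
    linarith

/-- The image of `K` is closed and has full measure, so it contains the support; the margin `ε`
places `K` in `(0,1)`, where computability lifts from the circle to the line. -/
theorem IsConstruction.not_isComputableMeasure {K : Set ℝ} {a b : ℕ → ℝ} {ε : ℚ}
    {f : ℕ → ℝ → ℝ} (h : IsConstruction K a b ε f) (hK : IsSeedSet K)
    (μ : Measure UnitAddCircle) [IsProbabilityMeasure μ]
    (hμ : MeasurePreserving (circleMap ε f) μ μ) : ¬ IsComputableMeasure μ := by
  intro hc
  obtain ⟨z, hz, hzc⟩ := exists_computable_mem_support μ hc
  have hclosed : IsClosed (((↑) : ℝ → UnitAddCircle) '' K) :=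
    (hK.recCompact.1.image (AddCircle.continuous_mk' 1)).isClosed
  have hzK : z ∈ ((↑) : ℝ → UnitAddCircle) '' K := by
    by_contra hn
    exact ((Measure.mem_support_iff_forall z).1 hz _ (hclosed.isOpen_compl.mem_nhds hn)).ne'
      (h.measure_compl_eq_zero hK μ hμ)
  obtain ⟨x, hx, rfl⟩ := hzK
  have hm := h.margin hx
  have hε := h.eps_pos
  exact hK.no_computable x hx
    (IsComputablePoint.of_circle ⟨by linarith [hm.1], by linarith [hm.2]⟩ hzc)

end NoComputableMeasure

end LabelBomb

open LabelBomb in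
theorem proposition6p2 :
    (∃ K : Set ℝ, IsSeedSet K) ∧
    (∀ K : Set ℝ, IsSeedSet K →
      (∃ (a b : ℕ → ℝ) (ε : ℚ), IsConstruction K a b ε (standardStep a b)) ∧
      ∀ (a b : ℕ → ℝ) (ε : ℚ) (f : ℕ → ℝ → ℝ), IsConstruction K a b ε f →
        (∀ x ∈ Icc (0 : ℝ) 1,
          circleMap ε f (x : UnitAddCircle) = (liftMap ε f x : UnitAddCircle)) ∧
        IsComputableMap (circleMap ε f) ∧
        (∀ μ : Measure UnitAddCircle, IsProbabilityMeasure μ →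
          MeasurePreserving (circleMap ε f) μ μ →
            μ (((↑) : ℝ → UnitAddCircle) '' K)ᶜ = 0) ∧
        ¬ ∃ μ : Measure UnitAddCircle, IsProbabilityMeasure μ ∧
          MeasurePreserving (circleMap ε f) μ μ ∧ IsComputableMeasure μ) ∧
    (∀ (X : Type*) [MetricSpace X] [ComputableMetricSpace X] [BoundedSpace X]
      [MeasurableSpace X] [BorelSpace X] (μ : Measure X), IsProbabilityMeasure μ →
        IsComputableMeasure μ → ∃ x ∈ μ.support, IsComputablePoint x) := by
  refine ⟨⟨_, isSeedSet_diagonalSet⟩, fun K hK => ⟨hK.exists_isConstruction, ?_⟩, ?_⟩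
  · intro a b ε f h
    refine ⟨fun x hx => h.circleMap_coe_eq_liftMap hK.nonempty hx,
      h.isComputableMap_circleMap hK.nonempty,
      fun μ hμ hT => h.measure_compl_eq_zero hK μ hT, ?_⟩
    rintro ⟨μ, hμ, hT, hc⟩
    exact h.not_isComputableMeasure hK μ hT hc
  · intro X _ _ _ _ _ μ hμ hc
    exact exists_computable_mem_support μ hc
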